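/- Fix an integer $b\ge 1$ and let $\omega=e^{2\pi i/b}$. Consider linear probing hash tables with $m\ge0$ buckets $0,\dots,m-1$ of capacity $b$ and $n\ge0$ keys labelled $1,\dots,n$; a table is given by a hash function $h:\{1,\dots,n\}\to\{0,\dots,m-1\}$. When $n\le bm$, the keys are inserted one at a time, in an arbitrary order (which may depend on $h$), by the Robin Hood rule: a key first tries its home bucket; whenever a key tries a full bucket, then among the $b$ keys stored there and the new one, the key that has been displaced least (in case of a tie, the one with the largest label) moves on to try the next bucket (cyclically). The displacement of a key is the number of buckets that it has tried without finally being placed there. For a key $x$ with $h(x)=0$ let $D^{RH}(x)$ be its displacement when all keys have been inserted, and let $C^{RH}(x)=Q+V$, where $Q$ is the number of keys that overflow from bucket $m-1$ into bucket $0$ and $V$ is the number of keys with hash address $0$ that win over $x$ in ties, i.e. that have a smaller label than $x$. When $n>bm$ (and $m\ge1$), put formally $C^{RH}(x)=Q+V$ and $D^{RH}(x)=\lfloor C^{RH}(x)/b\rfloor$, where now $Q=Q_{m-1}$ is the overflow from buckets $1,\dots,m-1$, defined by $Q_0=0$ and $Q_i=\max(Q_{i-1}+\#h^{-1}(i)-b,\,0)$.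 Let $CRH_{m,n,k}$ (respectively $C_{m,n,k}$) be the number of pairs $(h,x)$ of a hash table with $m$ buckets and $n$ keys and a marked key $x$ with $h(x)=0$ such that $D^{RH}(x)=k$ (respectively $C^{RH}(x)=k$), and let $$RH(z,w,q)=\sum_{m,n,k\ge0}CRH_{m,n,k}\,w^{bm}\frac{z^n}{n!}q^k,\qquad C(z,w,q)=\sum_{m,n,k\ge0}C_{m,n,k}\,w^{bm}\frac{z^n}{n!}q^k,\qquad T(u)=\sum_{n\ge1}\frac{n^{n-1}}{n!}u^n$$ (formal power series over $\mathbb C$). Then, for every choice of the insertion orders, $$RH(bz,w,q)=\frac1b\sum_{d=0}^{b-1}C\bigl(bz,w,\omega^dq^{1/b}\bigr)\sum_{p=0}^{b-1}\bigl(\omega^dq^{1/b}\bigr)^{-p}$$ as an identity in the field of fractions of $\mathbb C[[z,w,q^{1/b}]]$, and $$C(bz,w,q)=\frac{w^b\,(e^{bz}-e^{bzq})}{(1-q)(q^b-w^be^{bzq})}\cdot\frac{\prod_{j=0}^{b-1}\bigl(q-\frac{T(\omega^jzw)}{z}\bigr)}{\prod_{j=0}^{b-1}\bigl(1-\frac{T(\omega^jzw)}{z}\bigr)}$$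 in the field of fractions of $\mathbb C[[z,w,q]]$. -/

import Mathlib

/-! Linear probing hash tables with `m` buckets (numbered `0, …, m - 1`) of size `b`, with the
Robin Hood collision rule. The `n` keys are the elements of `Fin n`, ordered by their value, and
the table is given by its hash function `h : Fin n → Fin m`. -/

namespace RobinHood

noncomputable section

/-- A state of the table: `s y = some k` if key `y` is stored at displacement `k`, that is, in
bucket `(h y + k) mod m`, after `k` unsuccessful probes; `s y = none` if `y` is not in the table. -/
abbrev State (n : ℕ) := Fin n → Option ℕ

variable {m n : ℕ}

/-- The displacement of a key that is in the table (`0` by convention for the other keys). -/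
def State.disp (s : State n) (y : Fin n) : ℕ := (s y).getD 0

/-- The keys stored in bucket `i`. -/
def bucket (h : Fin n → Fin m) (s : State n) (i : ℕ) : Finset (Fin n) :=
  Finset.univ.filter fun y => ∃ k, s y = some k ∧ ((h y : ℕ) + k) % m = i

/-- The key of `B` that has to leave: the one with the smallest displacement and, among those,
the one with the largest value. -/
def loser (s : State n) (B : Finset (Fin n)) (hB : B.Nonempty) : Fin n :=
  (B.exists_min_image (fun y => toLex (s.disp y, OrderDual.toDual y)) hB).choose

/-- Key `y`, which is not in the table, tries bucket `(h y + k) mod m`. If there is room it stays.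
Otherwise the loser among the `b` keys there and `y` itself leaves and tries its next bucket.
The first argument bounds the number of probes; `m` probes suffice whenever at most `b * m` keys
are involved, since the probed buckets are consecutive. -/
def probe (b : ℕ) (h : Fin n → Fin m) : ℕ → State n → Fin n → ℕ → State n
  | 0, s, _, _ => s
  | fuel + 1, s, y, k =>
    let s' : State n := Function.update s y (some k)
    let B := bucket h s' (((h y : ℕ) + k) % m)
    if hB : B.card ≤ b then s'
    else
      let v := loser s' B (Finset.card_pos.mp (by omega))
      probe b h fuel (Function.update s' v none) v (s'.disp v + 1)

/-- Insertion of the key `y`. -/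
def insertKey (b : ℕ) (h : Fin n → Fin m) (s : State n) (y : Fin n) : State n :=
  probe b h m s y 0

/-- The Robin Hood hash table obtained by inserting the keys `σ 0, σ 1, …, σ (n - 1)`, in this
order, into an empty table. -/
def table (b : ℕ) (h : Fin n → Fin m) (σ : Equiv.Perm (Fin n)) : State n :=
  (List.ofFn σ).foldl (insertKey b h) (fun _ => none)

/-- The number of keys that overflow from the last bucket into bucket `0` in the Robin Hood
table. -/
def cyclicOverflow (b : ℕ) (h : Fin n → Fin m) (σ : Equiv.Perm (Fin n)) : ℕ :=
  (Finset.univ.filter fun y : Fin n => m ≤ (h y : ℕ) + (table b h σ).disp y).card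

/-- The number `X i` of keys that hash to bucket `i`. -/
def hashCount (h : Fin n → Fin m) (i : ℕ) : ℕ :=
  (Finset.univ.filter fun y : Fin n => (h y : ℕ) = i).card

/-- The overflow `Q i` from bucket `i` when only the buckets `1, 2, …, i` are considered:
`Q 0 = 0` and `Q (i + 1) = max (Q i + X (i + 1) - b) 0`. -/
def linearOverflow (b : ℕ) (h : Fin n → Fin m) : ℕ → ℕ
  | 0 => 0
  | i + 1 => linearOverflow b h i + hashCount h (i + 1) - b

/-- The number of keys that hash to bucket `0` and win over `x` (which hashes to `0` too). -/
def winners (h : Fin n → Fin m) (x : Fin n) : ℕ :=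
  (Finset.univ.filter fun y : Fin n => (h y : ℕ) = 0 ∧ y < x).card

/-- For a key `x` that hashes to bucket `0`, the number of keys that win over `x` in the
competition for slots: those that overflow into bucket `0` and those hashing to `0` that win
over `x`. If `n > b * m`, there is no hash table, and the overflow from the buckets
`1, …, m - 1` is used. -/
def cRH (b : ℕ) (h : Fin n → Fin m) (σ : Equiv.Perm (Fin n)) (x : Fin n) : ℕ :=
  (if n ≤ b * m then cyclicOverflow b h σ else linearOverflow b h (m - 1)) + winners h x

/-- The Robin Hood displacement of a key `x` that hashes to bucket `0`: the displacement at which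
it is finally stored if `n ≤ b * m`; if `n > b * m` it is defined as `⌊cRH / b⌋`. -/
def dRH (b : ℕ) (h : Fin n → Fin m) (σ : Equiv.Perm (Fin n)) (x : Fin n) : ℕ :=
  if n ≤ b * m then (table b h σ).disp x else cRH b h σ x / b

/-- An order of insertion for every hash function. -/
abbrev InsertionOrders := ∀ m n : ℕ, (Fin n → Fin m) → Equiv.Perm (Fin n)

/-- The number of hash tables of length `m` with `n` keys, one of them marked, such that the marked
key hashes to bucket `0` and has Robin Hood displacement `k`. -/
def countRH (b : ℕ) (σ : InsertionOrders) (m n k : ℕ) : ℕ :=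
  (Finset.univ.filter fun p : (Fin n → Fin m) × Fin n =>
    (p.1 p.2 : ℕ) = 0 ∧ dRH b p.1 (σ m n p.1) p.2 = k).card

/-- The number of hash tables of length `m` with `n` keys, one of them marked, such that the marked
key hashes to bucket `0` and exactly `k` keys win over it. -/
def countC (b : ℕ) (σ : InsertionOrders) (m n k : ℕ) : ℕ :=
  (Finset.univ.filter fun p : (Fin n → Fin m) × Fin n =>
    (p.1 p.2 : ℕ) = 0 ∧ cRH b p.1 (σ m n p.1) p.2 = k).card

/-- Formal power series over `ℂ` in the three variables `X 0` (`z`), `X 1` (`w`), `X 2` (`q`). -/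
abbrev Series := MvPowerSeries (Fin 3) ℂ

/-- The generating function `∑ a m n k * w ^ (b * m) * z ^ n / n! * q ^ k` (where `b ≥ 1`). -/
def genFun (b : ℕ) (a : ℕ → ℕ → ℕ → ℕ) : Series := fun e =>
  if b ∣ e 1 then (a (e 1 / b) (e 0) (e 2) : ℂ) / ((e 0).factorial : ℂ) else 0

/-- `RH(z, w, q)`. -/
def RH (b : ℕ) (σ : InsertionOrders) : Series := genFun b (countRH b σ)

/-- `C(z, w, q)`. -/
def CGF (b : ℕ) (σ : InsertionOrders) : Series := genFun b (countC b σ)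

/-- The tree function `T(u) = ∑_{n ≥ 1} n ^ (n - 1) / n! * u ^ n`. -/
def tree : PowerSeries ℂ :=
  PowerSeries.mk fun n => if n = 0 then 0 else (n : ℂ) ^ (n - 1) / (n.factorial : ℂ)

/-- The field of fractions of the ring of power series in three variables. -/
abbrev Frac := FractionRing Series

/-- A power series as an element of the field of fractions. -/
def toFrac (f : Series) : Frac := algebraMap Series Frac f

/-- The variable `z`. -/
def z : Series := MvPowerSeries.X 0
/-- The variable `w`. -/
def w : Series := MvPowerSeries.X 1
/-- The variable `q`. -/
def q : Series := MvPowerSeries.X 2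

/-- The power series `f(u₁, u₂, u₃)`, for power series `uᵢ` without constant term. -/
def at3 (f : Series) (u₁ u₂ u₃ : Series) : Series := MvPowerSeries.subst ![u₁, u₂, u₃] f

/-- The power series `f(u)`, for a power series `u` without constant term. -/
def at1 (f : PowerSeries ℂ) (u : Series) : Series := PowerSeries.subst u f

/-- The root of unity `ω = exp (2 * π * i / b)`. -/
def omega (b : ℕ) : ℂ := Complex.exp (2 * Real.pi * Complex.I / b)

end

end RobinHood

/-!
The final Robin Hood table obeys an invariant, `Settled`: a key has only left buckets that are full
of keys which beat it there. Hence, for a key `x` with home bucket `0` and displacement `k`, the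
`C` keys that win over `x` fill the buckets `0, …, k - 1` and share bucket `k` with `x`, so that
`k = ⌊C / b⌋` (`disp_eq_div`). This holds for each table separately, and turns into the first
identity by a filter over the `b`-th roots of unity (`sum_omega_mul_pow`).

When `n ≤ b * m`, some bucket has never overflowed: the one where the last insertion ended. The
cyclic recursion for the overflow therefore forgets what bucket `0` sends on, and the overflow into
bucket `0` is that of the line of buckets `1, …, m - 1` (`cyclicOverflow_eq`), as it is by
definition when `n > b * m`. So bucket `0` is independent of the rest. If `F` is the generating
function of the overflow from lines of all lengths, and a table in which `j` keys hash to bucket `0`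
has weight `1 + q + ⋯ + q ^ (j - 1)` for the choice of `x`, this gives
`(1 - q) * C(b z, w, q) = w ^ b * (exp (b z) - exp (b z q)) * F` (`one_sub_q_mul_CGF`).

Adding one bucket to the line gives the kernel equation
`F * (q ^ b - w ^ b * exp (b z q)) = q ^ b + ∑ s < b, (q ^ b - q ^ s) * Ω s`, where `Ω s` does not
involve `q` (`allOverflowGF_mul_kernel`). The right-hand side is a polynomial in `q` of degree at
most `b` with value `1` at `q = 1`, and it vanishes at the `b` distinct roots `T(ω ^ j z w) / z` of
the kernel, which determines it (`eval_mul_prod_one_sub`). That these are roots is the functional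
equation `T(u) = u * exp (T(u))` (`tree_eq`). It is proved by inverting `T(v * exp (-v)) = v`, whose
coefficients are iterated differences of powers.

Infinite sums of power series are taken in the topology of coefficientwise convergence.
-/

namespace RobinHood

/-! ### The Robin Hood invariant -/

section Table

variable {b m n : ℕ} {h : Fin n → Fin m} {s : State n}

/-- The key `v` of the table beats the key `u` arriving at displacement `j` at the bucket of `v`. -/
def Beats (s : State n) (v u : Fin n) (j : ℕ) : Prop :=
  ∃ k, s v = some k ∧ (j < k ∨ j = k ∧ v < u)

/-- The `j`-th bucket on the way of the key `u` is full, and all its keys beat `u` there: `u`, if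
not stored before, has to go on. -/
def Passed (b : ℕ) (h : Fin n → Fin m) (s : State n) (u : Fin n) (j : ℕ) : Prop :=
  b ≤ (bucket h s ((h u + j) % m)).card ∧ ∀ v ∈ bucket h s ((h u + j) % m), Beats s v u j

/-- The invariant of Robin Hood tables: no bucket is over capacity, and every key was rightly
rejected by all the buckets it has left. -/
def Settled (b : ℕ) (h : Fin n → Fin m) (s : State n) : Prop :=
  (∀ i, (bucket h s i).card ≤ b) ∧ ∀ u k, s u = some k → ∀ j < k, Passed b h s u j

/-- The bucket `i` has never overflowed: no key of the table has left it. -/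
def NeverLeft (h : Fin n → Fin m) (s : State n) (i : ℕ) : Prop :=
  ∀ u k, s u = some k → ∀ j < k, ((h u : ℕ) + j) % m ≠ i

lemma mem_bucket {i : ℕ} {y : Fin n} :
    y ∈ bucket h s i ↔ ∃ k, s y = some k ∧ ((h y : ℕ) + k) % m = i := by
  simp [bucket]

lemma bucket_update_some {y : Fin n} (hy : s y = none) (k i : ℕ) :
    bucket h (Function.update s y (some k)) i =
      if ((h y : ℕ) + k) % m = i then insert y (bucket h s i) else bucket h s i := by
  ext u
  by_cases hu : u = y
  · subst hu
    split_ifs with hi <;> simp [mem_bucket, hi, hy]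
  · split_ifs with hi <;> simp [mem_bucket, hu]

lemma bucket_update_none (v : Fin n) (i : ℕ) :
    bucket h (Function.update s v none) i = (bucket h s i).erase v := by
  ext u
  by_cases hu : u = v
  · subst hu; simp [mem_bucket]
  · simp [mem_bucket, hu]

lemma loser_mem {B : Finset (Fin n)} (hB : B.Nonempty) : loser s B hB ∈ B :=
  (B.exists_min_image (fun y => toLex (s.disp y, OrderDual.toDual y)) hB).choose_spec.1

lemma beats_loser {B : Finset (Fin n)} (hB : B.Nonempty) {u : Fin n} (hu : u ∈ B)
    (hne : u ≠ loser s B hB) {k : ℕ} (hk : s u = some k) :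
    Beats s u (loser s B hB) (s.disp (loser s B hB)) := by
  have h1 := (B.exists_min_image (fun y => toLex (s.disp y, OrderDual.toDual y)) hB).choose_spec.2
    u hu
  change toLex (s.disp (loser s B hB), OrderDual.toDual (loser s B hB)) ≤ _ at h1
  have h2 : s.disp u = k := by simp [State.disp, hk]
  rw [Prod.Lex.toLex_le_toLex, h2] at h1
  refine ⟨k, hk, h1.imp id fun h3 => ⟨h3.1, lt_of_le_of_ne ?_ hne⟩⟩
  simpa using h3.2

lemma Beats.trans {s' : State n} {x y u : Fin n} {k j : ℕ} (hxy : Beats s' x y k)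
    (hyu : Beats s y u j) (hk : s y = some k) : Beats s' x u j := by
  obtain ⟨k₁, h₁, h₁'⟩ := hxy
  obtain ⟨k₂, h₂, h₂'⟩ := hyu
  obtain rfl : k = k₂ := by simpa [hk] using h₂
  refine ⟨k₁, h₁, ?_⟩
  rcases h₁' with h₁' | ⟨rfl, h₁'⟩ <;> rcases h₂' with h₂' | ⟨rfl, h₂'⟩
  · exact .inl (h₂'.trans h₁')
  · exact .inl h₁'
  · exact .inl h₂'
  · exact .inr ⟨rfl, h₁'.trans h₂'⟩

lemma Beats.update_of_ne {v u y : Fin n} {j : ℕ} (hb : Beats s v u j) (hne : v ≠ y)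
    (o : Option ℕ) : Beats (Function.update s y o) v u j := by
  obtain ⟨k, h1, h2⟩ := hb
  exact ⟨k, by simpa [hne] using h1, h2⟩

section Swap

variable {y : Fin n} {k : ℕ}

/-- The key `v` is the one that has to leave the bucket where `y` was stored at displacement `k`. -/
structure Loses (h : Fin n → Fin m) (s : State n) (y : Fin n) (k : ℕ) (v : Fin n) (kv : ℕ) :
    Prop where
  stored : Function.update s y (some k) v = some kv
  mod_eq : ((h v : ℕ) + kv) % m = ((h y : ℕ) + k) % m
  beats : ∀ u ∈ bucket h (Function.update s y (some k)) (((h y : ℕ) + k) % m), u ≠ v →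
    Beats (Function.update s y (some k)) u v kv

lemma Loses.mem {v : Fin n} {kv : ℕ} (hv : Loses h s y k v kv) :
    v ∈ bucket h (Function.update s y (some k)) (((h y : ℕ) + k) % m) :=
  mem_bucket.2 ⟨kv, hv.stored, hv.mod_eq⟩

lemma loses_loser
    (hne : (bucket h (Function.update s y (some k)) (((h y : ℕ) + k) % m)).Nonempty) :
    Loses h s y k (loser (Function.update s y (some k)) _ hne)
      (State.disp (Function.update s y (some k))
        (loser (Function.update s y (some k)) _ hne)) := by
  obtain ⟨k', h1, h2⟩ := mem_bucket.1 (loser_mem (s := Function.update s y (some k)) hne)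
  have h3 : State.disp (Function.update s y (some k))
      (loser (Function.update s y (some k)) _ hne) = k' := by
    rw [State.disp, h1, Option.getD_some]
  refine ⟨by rw [h1, h3], by rw [h3, h2], fun u hu huv => ?_⟩
  obtain ⟨k', h1, -⟩ := mem_bucket.1 hu
  exact beats_loser hne hu huv h1

variable {v : Fin n} {kv : ℕ} (hs : Settled b h s) (hy : s y = none) (hv : Loses h s y k v kv)
  (hB : b < (bucket h (Function.update s y (some k)) (((h y : ℕ) + k) % m)).card)

include hy hv in
lemma bucket_swap_of_ne {i : ℕ} (hi : ((h y : ℕ) + k) % m ≠ i) :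
    bucket h (Function.update (Function.update s y (some k)) v none) i = bucket h s i := by
  rw [bucket_update_none, bucket_update_some hy, if_neg hi, Finset.erase_eq_of_notMem]
  intro hvi
  have h1 := hv.stored
  have h2 := hv.mod_eq
  obtain ⟨k', h3, h4⟩ := mem_bucket.1 hvi
  by_cases hvy : v = y
  · rw [hvy, hy] at h3; simp at h3
  · rw [Function.update_of_ne hvy, h3, Option.some_inj] at h1
    rw [← h1] at h2
    exact hi (h2.symm.trans h4)

include hs hy hv hB in
lemma card_bucket_swap :
    (bucket h (Function.update (Function.update s y (some k)) v none)
      (((h y : ℕ) + k) % m)).card = b := by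
  have h1 := hs.1 (((h y : ℕ) + k) % m)
  have h2 := Finset.card_insert_le y (bucket h s (((h y : ℕ) + k) % m))
  rw [bucket_update_none, Finset.card_erase_of_mem hv.mem]
  rw [bucket_update_some hy, if_pos rfl] at hB ⊢
  omega

include hs hy hv hB in
/-- What `u` has passed stays passed when `y` displaces the loser of a bucket: if `u` passed that
bucket, `y` beats `u` there because it beats the loser, which beats `u`. -/
lemma Passed.swap {u : Fin n} {j : ℕ} (hp : Passed b h s u j) :
    Passed b h (Function.update (Function.update s y (some k)) v none) u j := by
  by_cases hi : ((h y : ℕ) + k) % m = ((h u : ℕ) + j) % m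
  · refine ⟨?_, fun x hx => ?_⟩
    · rw [← hi, card_bucket_swap hs hy hv hB]
    · have hx' := hx
      rw [bucket_update_none, Finset.mem_erase, bucket_update_some hy, if_pos hi,
        Finset.mem_insert] at hx'
      obtain ⟨hxv, rfl | hxs⟩ := hx'
      · -- `x` is the newcomer, which beats the key that has left, and that one beats `u`
        obtain ⟨k', hk', -⟩ := mem_bucket.1 hx
        have hvx : v ≠ x := fun h => hxv h.symm
        have hvm := hv.mem
        have hl := hv.beats x
          (by rw [bucket_update_some hy, if_pos rfl]; exact Finset.mem_insert_self _ _) hxv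
        have hst := hv.stored
        rw [Function.update_of_ne hvx] at hst
        refine Beats.trans (hl.update_of_ne hxv none) (hp.2 v ?_) hst
        rw [bucket_update_some hy, if_pos rfl, Finset.mem_insert, hi] at hvm
        exact hvm.resolve_left hvx
      · refine ((hp.2 x hxs).update_of_ne ?_ _).update_of_ne hxv _
        rintro rfl
        obtain ⟨k', hk', -⟩ := mem_bucket.1 hxs
        simp [hy] at hk'
  · have hbu := bucket_swap_of_ne (h := h) hy hv hi
    refine ⟨by rw [hbu]; exact hp.1, fun x hx => ?_⟩
    have hx' := hx
    rw [hbu] at hx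
    rw [bucket_update_none, Finset.mem_erase] at hx'
    refine ((hp.2 x hx).update_of_ne ?_ _).update_of_ne hx'.1 _
    rintro rfl
    obtain ⟨k', hk', -⟩ := mem_bucket.1 hx
    simp [hy] at hk'

include hs hy hv hB in
lemma passed_loser : Passed b h (Function.update (Function.update s y (some k)) v none) v kv := by
  have h1 := hv.stored; have h2 := hv.mod_eq
  refine ⟨by rw [h2, card_bucket_swap hs hy hv hB], fun x hx => ?_⟩
  rw [h2, bucket_update_none, Finset.mem_erase] at hx
  exact (hv.beats x hx.2 hx.1).update_of_ne hx.1 _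

include hs hy hv hB in
lemma Settled.swap (hp : ∀ j < k, Passed b h s y j) :
    Settled b h (Function.update (Function.update s y (some k)) v none) ∧
      ∀ j < kv + 1, Passed b h (Function.update (Function.update s y (some k)) v none) v j := by
  have key : ∀ u k', Function.update s y (some k) u = some k' → ∀ j < k', Passed b h s u j := by
    intro u k' hu j hj
    by_cases huy : u = y
    · subst huy
      rw [Function.update_self, Option.some_inj] at hu
      exact hp j (hu ▸ hj)
    · rw [Function.update_of_ne huy] at hu
      exact hs.2 u k' hu j hj
  refine ⟨⟨fun i => ?_, fun u k' hu j hj => ?_⟩, fun j hj => ?_⟩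
  · by_cases hi : ((h y : ℕ) + k) % m = i
    · rw [← hi, card_bucket_swap hs hy hv hB]
    · rw [bucket_swap_of_ne hy hv hi]; exact hs.1 i
  · by_cases huv : u = v
    · rw [huv, Function.update_self] at hu; simp at hu
    · rw [Function.update_of_ne huv] at hu
      exact (key u k' hu j hj).swap hs hy hv hB
  · rcases Nat.lt_succ_iff_lt_or_eq.1 hj with hj | rfl
    · exact (key v _ hv.stored j hj).swap hs hy hv hB
    · exact passed_loser hs hy hv hB

end Swap

/-- Storing a key in a bucket with room preserves the invariant, and nobody has left that bucket. -/
lemma Settled.store {y : Fin n} {k : ℕ} (hs : Settled b h s) (hy : s y = none)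
    (hp : ∀ j < k, Passed b h s y j)
    (hB : (bucket h (Function.update s y (some k)) (((h y : ℕ) + k) % m)).card ≤ b) :
    Settled b h (Function.update s y (some k)) ∧
      NeverLeft h (Function.update s y (some k)) (((h y : ℕ) + k) % m) := by
  have hyb : ∀ i, y ∉ bucket h s i := fun i hi => by
    obtain ⟨k', hk', -⟩ := mem_bucket.1 hi
    simp [hy] at hk'
  have hroom : (bucket h s (((h y : ℕ) + k) % m)).card < b := by
    rw [bucket_update_some hy, if_pos rfl, Finset.card_insert_of_notMem (hyb _)] at hB
    exact hB
  have key : ∀ u k', Function.update s y (some k) u = some k' → ∀ j < k', Passed b h s u j := by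
    intro u k' hu j hj
    by_cases huy : u = y
    · subst huy
      rw [Function.update_self, Option.some_inj] at hu
      exact hp j (hu ▸ hj)
    · rw [Function.update_of_ne huy] at hu
      exact hs.2 u k' hu j hj
  have hnl : NeverLeft h (Function.update s y (some k)) (((h y : ℕ) + k) % m) := by
    intro u k' hu j hj he
    have := (key u k' hu j hj).1
    rw [he] at this
    omega
  refine ⟨⟨fun i => ?_, fun u k' hu j hj => ?_⟩, hnl⟩
  · by_cases hi : ((h y : ℕ) + k) % m = i
    · rw [← hi]; exact hB
    · rw [bucket_update_some hy, if_neg hi]; exact hs.1 i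
  · have hi := hnl u k' hu j hj
    have hpa := key u k' hu j hj
    unfold Passed
    rw [bucket_update_some hy, if_neg (Ne.symm hi)]
    refine ⟨hpa.1, fun x hx => (hpa.2 x hx).update_of_ne ?_ _⟩
    rintro rfl
    exact hyb _ hx

/-- If there are at most `b * m` keys and one of them is not in the table, some bucket has room. -/
lemma not_all_full (hn : n ≤ b * m) {y : Fin n} (hy : s y = none)
    (hf : ∀ i < m, b ≤ (bucket h s i).card) : False := by
  have h1 : ((Finset.range m).biUnion (bucket h s)).card = ∑ i ∈ Finset.range m,
      (bucket h s i).card := by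
    refine Finset.card_biUnion fun i _ j _ hij => Finset.disjoint_left.2 fun x hx hx' => hij ?_
    obtain ⟨k, hk, rfl⟩ := mem_bucket.1 hx
    obtain ⟨k', hk', rfl⟩ := mem_bucket.1 hx'
    rw [hk, Option.some_inj] at hk'
    rw [hk']
  have h2 : ((Finset.range m).biUnion (bucket h s)) ⊆ Finset.univ.erase y := by
    intro x hx
    obtain ⟨i, -, hi⟩ := Finset.mem_biUnion.1 hx
    obtain ⟨k, hk, -⟩ := mem_bucket.1 hi
    refine Finset.mem_erase.2 ⟨?_, Finset.mem_univ _⟩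
    rintro rfl
    simp [hy] at hk
  have h3 := Finset.card_le_card h2
  have h4 : m * b ≤ ∑ i ∈ Finset.range m, (bucket h s i).card := by
    have := Finset.card_nsmul_le_sum (Finset.range m) (fun i => (bucket h s i).card) b
      (fun i hi => hf i (Finset.mem_range.1 hi))
    simpa using this
  rw [Finset.card_erase_of_mem (Finset.mem_univ _), Finset.card_univ, Fintype.card_fin] at h3
  have : 0 < n := y.pos
  rw [mul_comm] at h4
  omega

lemma exists_add_mod_eq (a : ℕ) {i : ℕ} (hi : i < m) : ∃ t < m, (a + t) % m = i := by
  refine ⟨(i + (m - a % m)) % m, Nat.mod_lt _ (by omega), ?_⟩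
  have h1 : a % m < m := Nat.mod_lt _ (by omega)
  rw [Nat.add_mod_mod, ← Nat.mod_add_mod, show a % m + (i + (m - a % m)) = i + m by omega,
    Nat.add_mod_right, Nat.mod_eq_of_lt hi]

/-- Inserting a key preserves the invariant, and the bucket with room where the insertion ends is
one that no key has left. The buckets probed so far, which start at bucket `a`, are full; so the
fuel cannot run out, as then all `m` buckets would be full with one key left over. -/
theorem probe_spec (hn : n ≤ b * m) (fuel : ℕ) : ∀ (s : State n) (y : Fin n) (k : ℕ), fuel ≤ m →
    Settled b h s → s y = none → (∀ j < k, Passed b h s y j) →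
    (∃ a, ((h y : ℕ) + k) % m = (a + (m - fuel)) % m ∧
      ∀ t < m - fuel, b ≤ (bucket h s ((a + t) % m)).card) →
    Settled b h (probe b h fuel s y k) ∧ (∃ i < m, NeverLeft h (probe b h fuel s y k) i) ∧
      ∀ u, probe b h fuel s y k u ≠ none ↔ s u ≠ none ∨ u = y := by
  induction fuel with
  | zero =>
    rintro s y k - hs hy hp ⟨a, -, hfull⟩
    refine (not_all_full (h := h) hn hy fun i hi => ?_).elim
    obtain ⟨t, ht, rfl⟩ := exists_add_mod_eq a hi
    exact hfull t ht
  | succ fuel ih =>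
    rintro s y k hfuel hs hy hp ⟨a, ha, hfull⟩
    rw [probe]
    dsimp only
    split_ifs with hB
    · obtain ⟨h1, h2⟩ := hs.store hy hp hB
      refine ⟨h1, ⟨_, Nat.mod_lt _ (by omega), h2⟩, fun u => ?_⟩
      by_cases hu : u = y
      · subst hu; simp
      · simp [hu]
    · have hne : (bucket h (Function.update s y (some k)) (((h y : ℕ) + k) % m)).Nonempty :=
        Finset.card_pos.mp (by omega)
      push Not at hB
      have hv := loses_loser hne
      obtain ⟨h1, h2⟩ := hs.swap hy hv hB hp
      have hv1 := hv.stored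
      have hv2 := hv.mod_eq
      have hrun := ih _ _ _ (by omega) h1 (Function.update_self ..) h2 ⟨a, ?_, ?_⟩
      · obtain ⟨h3, h4, h5⟩ := hrun
        refine ⟨h3, h4, fun u => ?_⟩
        rw [h5]
        by_cases huv : u = loser (Function.update s y (some k))
          (bucket h (Function.update s y (some k)) (((h y : ℕ) + k) % m)) hne
        · simp only [huv, or_true, true_iff]
          by_cases hvy : loser (Function.update s y (some k))
              (bucket h (Function.update s y (some k)) (((h y : ℕ) + k) % m)) hne = y
          · exact .inr hvy
          · rw [Function.update_of_ne hvy] at hv1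
            left; rw [hv1]; simp
        · rw [Function.update_of_ne huv]
          by_cases huy : u = y
          · subst huy; simp
          · simp [huy, huv]
      · rw [← add_assoc, ← Nat.mod_add_mod, hv2, ha, Nat.mod_add_mod]
        congr 1; omega
      · intro t ht
        by_cases hi : ((h y : ℕ) + k) % m = (a + t) % m
        · rw [← hi, card_bucket_swap hs hy hv hB]
        · rw [bucket_swap_of_ne hy hv hi]
          refine hfull t ?_
          have : t ≠ m - (fuel + 1) := by rintro rfl; exact hi ha
          omega

theorem insertKeys_spec (hn : n ≤ b * m) (l : List (Fin n)) : ∀ s : State n,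
    l.Nodup → (∀ y ∈ l, s y = none) → Settled b h s → (∃ i < m, NeverLeft h s i) →
    Settled b h (l.foldl (insertKey b h) s) ∧
      (∃ i < m, NeverLeft h (l.foldl (insertKey b h) s) i) ∧
      ∀ u, l.foldl (insertKey b h) s u ≠ none ↔ s u ≠ none ∨ u ∈ l := by
  induction l with
  | nil => intro s _ _ hs hi; exact ⟨hs, hi, by simp⟩
  | cons y l ih =>
    intro s hl hls hs hi
    obtain ⟨h1, h2, h3⟩ := probe_spec (h := h) hn m s y 0 le_rfl hs (hls y (by simp)) (by simp)
      ⟨h y, by simp, by simp⟩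
    rw [List.nodup_cons] at hl
    have hkeys := ih (insertKey b h s y) hl.2 ?_ h1 h2
    · obtain ⟨h4, h5, h6⟩ := hkeys
      refine ⟨h4, h5, fun u => ?_⟩
      rw [List.foldl_cons, h6, insertKey, h3, List.mem_cons, or_assoc]
    · intro u hu
      by_contra hne
      rcases (h3 u).1 hne with h7 | rfl
      · exact h7 (hls u (by simp [hu]))
      · exact hl.1 hu

theorem table_spec (hn : n ≤ b * m) (hm : 0 < m) (σ : Equiv.Perm (Fin n)) :
    Settled b h (table b h σ) ∧ (∃ i < m, NeverLeft h (table b h σ) i) ∧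
      ∀ u, table b h σ u = some ((table b h σ).disp u) := by
  obtain ⟨h1, h2, h3⟩ := insertKeys_spec (b := b) (h := h) hn (List.ofFn σ) (fun _ => none)
    (List.nodup_ofFn.2 σ.injective) (by simp) ⟨fun i => by simp [bucket], by simp⟩
    ⟨0, hm, by simp [NeverLeft]⟩
  refine ⟨h1, h2, fun u => ?_⟩
  have : table b h σ u ≠ none := (h3 u).2 (.inr (by
    rw [List.mem_ofFn]; exact ⟨σ.symm u, by simp⟩))
  obtain ⟨k, hk⟩ := Option.ne_none_iff_exists'.1 this
  simp [State.disp, hk]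

end Table

/-! ### Overflow and displacement in the final table -/

section Final

variable {b m n : ℕ} {h : Fin n → Fin m} {s : State n}

/-- The number of steps from bucket `a` to bucket `i`, cyclically among `m` buckets. -/
def steps (m a i : ℕ) : ℕ := if a ≤ i then i - a else i + m - a

lemma add_mod_eq_iff_steps {a k i : ℕ} (ha : a < m) (hk : k < m) (hi : i < m) :
    (a + k) % m = i ↔ steps m a i = k := by
  unfold steps
  rcases lt_or_ge (a + k) m with h | h
  · rw [Nat.mod_eq_of_lt h]; split_ifs <;> omega
  · rw [Nat.mod_eq_sub_mod h, Nat.mod_eq_of_lt (by omega)]; split_ifs <;> omega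

lemma NeverLeft.disp_lt {i : ℕ} (hi : i < m) (hl : NeverLeft h s i)
    (hs : ∀ u, s u = some (s.disp u)) (u : Fin n) : s.disp u < m := by
  by_contra! hge
  obtain ⟨t, ht, h1⟩ := exists_add_mod_eq (h u) hi
  exact hl u _ (hs u) t (by omega) h1

/-- The number of keys that overflow from bucket `i` in the table `s`, where no key is displaced by
`m` or more. -/
def overflow (h : Fin n → Fin m) (s : State n) (i : ℕ) : ℕ :=
  (Finset.univ.filter fun y : Fin n => steps m (h y) i < s.disp y).card

variable (hs : Settled b h s) (ht : ∀ u, s u = some (s.disp u)) (hd : ∀ u, s.disp u < m)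

include ht hd in
lemma bucket_eq_filter {i : ℕ} (hi : i < m) :
    bucket h s i = Finset.univ.filter fun y : Fin n => steps m (h y) i = s.disp y := by
  ext y
  simp only [mem_bucket, ht y, Option.some_inj, Finset.mem_filter, Finset.mem_univ, true_and,
    exists_eq_left']
  exact add_mod_eq_iff_steps (h y).2 (hd y) hi

include hs ht hd in
/-- The overflow of the table satisfies the recursion that defines the linear overflow. -/
lemma overflow_succ {i : ℕ} (hi : i + 1 < m) :
    overflow h s (i + 1) = overflow h s i + hashCount h (i + 1) - b := by
  have hbal : overflow h s i + hashCount h (i + 1) =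
      (bucket h s (i + 1)).card + overflow h s (i + 1) := by
    rw [bucket_eq_filter ht hd hi, overflow, overflow, hashCount,
      ← Finset.card_union_of_disjoint, ← Finset.card_union_of_disjoint]
    · congr 1
      ext y
      have h1 := (h y).2
      have h2 := hd y
      simp only [Finset.mem_union, Finset.mem_filter, Finset.mem_univ, true_and]
      unfold steps
      split_ifs <;> omega
    · rw [Finset.disjoint_filter]
      intro y _ h1
      omega
    · rw [Finset.disjoint_filter]
      intro y _ h1 h2
      have h3 := hd y
      rw [steps, if_neg (by omega)] at h1
      omega
  have hcap := hs.1 (i + 1)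
  rcases Nat.eq_zero_or_pos (overflow h s (i + 1)) with h0 | hpos
  · omega
  · obtain ⟨y, hy⟩ := Finset.card_pos.1 hpos
    rw [Finset.mem_filter] at hy
    have h1 := (hs.2 y _ (ht y) _ hy.2).1
    rw [(add_mod_eq_iff_steps (h y).2 (hy.2.trans (hd y)) hi).2 rfl] at h1
    omega

/-- Since some bucket does not overflow at all, what overflows from the last bucket does not depend
on what overflows from bucket `0`. -/
theorem cyclicOverflow_eq (hn : n ≤ b * m) (hm : 0 < m) (σ : Equiv.Perm (Fin n)) :
    cyclicOverflow b h σ = linearOverflow b h (m - 1) := by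
  obtain ⟨hs, ⟨i₀, hi₀, hl⟩, ht⟩ := table_spec (h := h) hn hm σ
  have hd := hl.disp_lt hi₀ ht
  have hQ : cyclicOverflow b h σ = overflow h (table b h σ) (m - 1) := by
    unfold cyclicOverflow overflow
    congr 1
    ext y
    have h1 := (h y).2
    simp only [Finset.mem_filter, Finset.mem_univ, true_and]
    unfold steps
    rw [if_pos (by omega)]
    omega
  have hle : ∀ i < m, linearOverflow b h i ≤ overflow h (table b h σ) i := by
    intro i
    induction i with
    | zero => intro _; exact Nat.zero_le _
    | succ i ih =>
      intro hi
      have := ih (by omega)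
      rw [overflow_succ hs ht hd hi, linearOverflow]
      omega
  have h0 : overflow h (table b h σ) i₀ = 0 := by
    rw [overflow, Finset.card_eq_zero, Finset.filter_eq_empty_iff]
    intro y _ hy
    exact hl y _ (ht y) _ hy ((add_mod_eq_iff_steps (h y).2 (hy.trans (hd y)) hi₀).2 rfl)
  have heq : ∀ j, i₀ + j < m →
      linearOverflow b h (i₀ + j) = overflow h (table b h σ) (i₀ + j) := by
    intro j
    induction j with
    | zero => intro _; have := hle i₀ hi₀; simp only [add_zero]; omega
    | succ j ih =>
      intro hj
      rw [← add_assoc, overflow_succ hs ht hd (show i₀ + j + 1 < m from hj), linearOverflow,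
        ih (by omega)]
  rw [hQ, show m - 1 = i₀ + (m - 1 - i₀) by omega, heq _ (by omega)]

/-- If `x` hashes to bucket `0` and has displacement `k`, the winners over `x` fill the buckets
`0, …, k - 1` and share bucket `k` with `x`. -/
theorem disp_eq_div (hn : n ≤ b * m) (σ : Equiv.Perm (Fin n)) {x : Fin n} (hx : (h x : ℕ) = 0) :
    (table b h σ).disp x = (cyclicOverflow b h σ + winners h x) / b := by
  have hm : 0 < m := (h x).pos
  obtain ⟨hs, ⟨i₀, hi₀, hl⟩, ht⟩ := table_spec (h := h) hn hm σ
  have hd := hl.disp_lt hi₀ ht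
  generalize hsdef : table b h σ = s at hs hl ht hd
  set k := s.disp x with hk
  have hkm : k < m := hd x
  set W : Finset (Fin n) := Finset.univ.filter
    fun y => m ≤ (h y : ℕ) + s.disp y ∨ (h y : ℕ) = 0 ∧ y < x with hW
  have hcard : cyclicOverflow b h σ + winners h x = W.card := by
    rw [cyclicOverflow, winners, hsdef, ← Finset.card_union_of_disjoint, hW, Finset.filter_or]
    rw [Finset.disjoint_filter]
    intro y _ h1 h2
    have := hd y
    omega
  have hdisj : ∀ I : Finset ℕ, (I : Set ℕ).PairwiseDisjoint (bucket h s) := by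
    intro I i _ j _ hij
    refine Finset.disjoint_left.2 fun y hy hy' => hij ?_
    obtain ⟨k, hk, rfl⟩ := mem_bucket.1 hy
    obtain ⟨k', hk', rfl⟩ := mem_bucket.1 hy'
    rw [hk, Option.some_inj] at hk'
    rw [hk']
  have hmod : ∀ j ≤ k, ((h x : ℕ) + j) % m = j := fun j hj => by
    rw [hx, zero_add, Nat.mod_eq_of_lt (by omega)]
  have hlow : b * k ≤ W.card := by
    have hsub : (Finset.range k).biUnion (bucket h s) ⊆ W := by
      intro y hy
      obtain ⟨j, hj, hyj⟩ := Finset.mem_biUnion.1 hy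
      rw [Finset.mem_range] at hj
      have hp := hs.2 x k (ht x) j hj
      obtain ⟨d, hyd, hbt⟩ := hp.2 y (by rw [hmod j hj.le]; exact hyj)
      rw [ht y, Option.some_inj] at hyd
      rw [bucket_eq_filter ht hd (by omega), Finset.mem_filter, hyd, steps] at hyj
      have h1 := hyj.2
      have h2 := (h y).2
      rw [hW, Finset.mem_filter, hyd]
      refine ⟨Finset.mem_univ _, ?_⟩
      rcases hbt with hbt | ⟨rfl, hbt⟩
      · left; split_ifs at h1 <;> omega
      · right; refine ⟨?_, hbt⟩; split_ifs at h1 <;> omega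
    refine le_trans ?_ (Finset.card_le_card hsub)
    rw [Finset.card_biUnion fun i hi j hj hij => hdisj _ hi hj hij]
    have := Finset.card_nsmul_le_sum (Finset.range k) (fun i => (bucket h s i).card) b ?_
    · simpa [mul_comm] using this
    · intro j hj
      have hj' := Finset.mem_range.1 hj
      have hp := (hs.2 x k (ht x) j hj').1
      rwa [hmod j hj'.le] at hp
  have hupp : W.card + 1 ≤ b * (k + 1) := by
    have hxW : x ∉ W := by
      rw [hW, Finset.mem_filter]
      rintro ⟨-, h1 | h1⟩
      · omega
      · exact lt_irrefl _ h1.2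
    have hxk : x ∈ bucket h s k := mem_bucket.2 ⟨k, ht x, hmod k le_rfl⟩
    have hsub : insert x W ⊆ (Finset.range (k + 1)).biUnion (bucket h s) := by
      intro y hy
      rw [Finset.mem_biUnion]
      rw [Finset.mem_insert] at hy
      rcases hy with rfl | hy
      · exact ⟨k, Finset.mem_range.2 (Nat.lt_succ_self k), hxk⟩
      refine ⟨((h y : ℕ) + s.disp y) % m, ?_, mem_bucket.2 ⟨_, ht y, rfl⟩⟩
      by_contra hgt
      rw [Finset.mem_range, not_lt, Nat.succ_le_iff] at hgt
      -- a winner stored beyond bucket `k` would have been beaten by `x` there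
      have hyd := hd y
      have hym := (h y).2
      rw [hW, Finset.mem_filter] at hy
      rcases hy.2 with h1 | ⟨h1, h2⟩
      · rw [Nat.mod_eq_sub_mod h1, Nat.mod_eq_of_lt (by omega)] at hgt
        have hp := (hs.2 y _ (ht y) (m + k - h y) (by omega)).2 x (by
          rw [show (h y : ℕ) + (m + k - h y) = k + m by omega, Nat.add_mod_right,
            Nat.mod_eq_of_lt hkm]
          exact hxk)
        obtain ⟨k', h3, h4⟩ := hp
        rw [ht x, Option.some_inj] at h3
        omega
      · rw [h1, zero_add, Nat.mod_eq_of_lt hyd] at hgt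
        have hp := (hs.2 y _ (ht y) k hgt).2 x (by
          rw [h1, zero_add, Nat.mod_eq_of_lt hkm]
          exact hxk)
        obtain ⟨k', h3, h4⟩ := hp
        rw [ht x, Option.some_inj] at h3
        rcases h4 with h4 | h4
        · omega
        · exact lt_asymm h2 h4.2
    have h1 := Finset.card_le_card hsub
    rw [Finset.card_insert_of_notMem hxW] at h1
    refine h1.trans ((Finset.card_biUnion_le).trans ?_)
    have := Finset.sum_le_card_nsmul (Finset.range (k + 1)) (fun i => (bucket h s i).card) b
      fun i _ => hs.1 i
    simpa [mul_comm] using this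
  rw [hcard]
  symm
  rw [Nat.div_eq_iff (by rcases Nat.eq_zero_or_pos b with rfl | hb <;> omega)]
  rw [mul_add, mul_one] at hupp
  rw [mul_comm k b]
  omega

/-- The number of winners over `x`, in the common form for `n ≤ b * m` and `n > b * m`. -/
theorem cRH_eq (σ : Equiv.Perm (Fin n)) (x : Fin n) :
    cRH b h σ x = linearOverflow b h (m - 1) + winners h x := by
  rw [cRH]
  split_ifs with hn
  · rw [cyclicOverflow_eq hn (h x).pos]
  · rfl

theorem dRH_eq (σ : Equiv.Perm (Fin n)) {x : Fin n} (hx : (h x : ℕ) = 0) :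
    dRH b h σ x = cRH b h σ x / b := by
  rw [dRH, cRH]
  split_ifs with hn
  · exact disp_eq_div hn σ hx
  · rfl

end Final

/-! ### The tree function -/

section Tree

open PowerSeries

/-- An alternating sum of powers, which is an iterated difference of a power of lower order. -/
lemma alternating_sum_tree (N : ℕ) (hN : 2 ≤ N) :
    ∑ d ∈ Finset.range (N + 1), (if d = 0 then 0 else (d : ℂ) ^ (d - 1) / (d.factorial : ℂ)) *
      ((-(d : ℂ)) ^ (N - d) / ((N - d).factorial : ℂ)) = 0 := by
  have h := fwdDiff_iter_eq_sum_shift (1 : ℂ) (fun r : ℂ => r ^ (N - 1)) N 0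
  rw [fwdDiff_iter_pow_eq_zero_of_lt (by omega)] at h
  have hf : (N.factorial : ℂ) ≠ 0 := Nat.cast_ne_zero.2 N.factorial_ne_zero
  refine (mul_eq_zero_iff_left hf).1 ?_
  rw [Finset.mul_sum]
  refine Eq.trans (Finset.sum_congr rfl fun d hd => ?_) h.symm
  have hdN : d ≤ N := Nat.lt_succ_iff.1 (Finset.mem_range.1 hd)
  rcases Nat.eq_zero_or_pos d with rfl | hd0
  · simp [show N - 1 ≠ 0 by omega]
  · have h1 : (d.factorial : ℂ) ≠ 0 := Nat.cast_ne_zero.2 d.factorial_ne_zero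
    have h2 : ((N - d).factorial : ℂ) ≠ 0 := Nat.cast_ne_zero.2 (N - d).factorial_ne_zero
    have h3 : (d : ℂ) ^ (N - 1) = (d : ℂ) ^ (d - 1) * (d : ℂ) ^ (N - d) := by
      rw [← pow_add]; congr 1; omega
    have h4 : (N.factorial : ℂ) = N.choose d * d.factorial * (N - d).factorial := by
      rw [← Nat.choose_mul_factorial_mul_factorial hdN]; push_cast; ring
    simp only [zero_add, nsmul_eq_mul, mul_one, zsmul_eq_mul]
    push_cast
    rw [if_neg hd0.ne', h3, h4, neg_pow (d : ℂ)]
    field_simp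

/-- `T(v * exp(-v)) = v`. -/
lemma tree_subst : tree.subst (X * rescale (-1) (exp ℂ) : PowerSeries ℂ) = X := by
  have hs : HasSubst (X * rescale (-1) (exp ℂ) : PowerSeries ℂ) :=
    HasSubst.of_constantCoeff_zero' (by simp)
  ext N
  have hco : ∀ d, coeff N ((X * rescale (-1) (exp ℂ) : PowerSeries ℂ) ^ d) =
      if d ≤ N then (-(d : ℂ)) ^ (N - d) / ((N - d).factorial : ℂ) else 0 := by
    intro d
    rw [mul_pow, ← map_pow, exp_pow_eq_rescale_exp, coeff_X_pow_mul']
    split_ifs with hd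
    · rw [coeff_rescale, coeff_rescale, coeff_exp, neg_pow (d : ℂ)]
      simp [div_eq_mul_inv, mul_assoc]
    · rfl
  rw [coeff_subst' hs, finsum_eq_sum_of_support_subset (s := Finset.range (N + 1))]
  · have h1 : ∀ d ∈ Finset.range (N + 1), coeff d tree •
        coeff N ((X * rescale (-1) (exp ℂ) : PowerSeries ℂ) ^ d) =
        (if d = 0 then 0 else (d : ℂ) ^ (d - 1) / (d.factorial : ℂ)) *
        ((-(d : ℂ)) ^ (N - d) / ((N - d).factorial : ℂ)) := by
      intro d hd
      rw [hco, if_pos (Nat.lt_succ_iff.1 (Finset.mem_range.1 hd)), tree, coeff_mk, smul_eq_mul]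
    rw [Finset.sum_congr rfl h1, coeff_X]
    split_ifs with hN
    · subst hN
      simp [Finset.sum_range_succ]
    · rcases Nat.eq_zero_or_pos N with rfl | hN'
      · simp
      · exact alternating_sum_tree N (by omega)
  · intro d hd
    rw [Function.mem_support, hco] at hd
    rw [Finset.mem_coe, Finset.mem_range, Nat.lt_succ_iff]
    by_contra hlt
    simp [hlt] at hd

lemma constantCoeff_tree : constantCoeff tree = 0 := by
  rw [← coeff_zero_eq_constantCoeff_apply, tree, coeff_mk, if_pos rfl]

lemma hasSubst_tree : HasSubst tree := HasSubst.of_constantCoeff_zero' constantCoeff_tree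

/-- The functional equation `T(u) = u * exp(T(u))`. It follows from `T(v * exp(-v)) = v`, since a
compositional left inverse is a right inverse. -/
lemma tree_eq : tree = X * (exp ℂ).subst tree := by
  set f : PowerSeries ℂ := X * rescale (-1) (exp ℂ) with hf
  have hf0 : constantCoeff f = 0 := by simp [hf]
  have hf1 : IsUnit (coeff 1 f) := by
    rw [hf, show (1 : ℕ) = 0 + 1 from rfl, coeff_succ_X_mul]; simp
  have hinv : tree = f.substInvOfIsUnit hf1 := by
    have h1 := subst_comp_subst_apply (HasSubst.of_constantCoeff_zero' hf0)
      (HasSubst.substInvOfIsUnit f hf1) tree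
    rw [tree_subst, subst_substInvOfIsUnit_right f hf0, subst_X (HasSubst.substInvOfIsUnit f hf1),
      X_subst] at h1
    exact h1.symm
  have h2 := subst_substInvOfIsUnit_right f hf0 hf1
  rw [← hinv, hf, subst_mul hasSubst_tree, subst_X hasSubst_tree] at h2
  have h3 : (rescale (-1) (exp ℂ)).subst tree * (exp ℂ).subst tree = (1 : PowerSeries ℂ) := by
    rw [← subst_mul hasSubst_tree, mul_comm]
    have := exp_mul_exp_neg_eq_one (A := ℂ)
    rw [evalNegHom] at this
    rw [this, ← coe_substAlgHom hasSubst_tree, map_one]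
  calc tree = tree * ((rescale (-1) (exp ℂ)).subst tree * (exp ℂ).subst tree) := by
        rw [h3, mul_one]
    _ = X * (exp ℂ).subst tree := by rw [← mul_assoc, h2]

end Tree

open MvPowerSeries
open scoped MvPowerSeries.WithPiTopology

/-! ### Sums of power series -/

section Sums

/-- A power series in other power series is the sum of its terms. -/
lemma hasSum_subst {κ τ : Type*} {a : κ → MvPowerSeries τ ℂ} (ha : HasSubst a)
    (f : MvPowerSeries κ ℂ) :
    HasSum (fun d : κ →₀ ℕ => C (coeff d f) * d.prod fun i k => a i ^ k) (subst a f) := by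
  rw [WithPiTopology.hasSum_iff_hasSum_coeff]
  intro e
  simp only [coeff_C_mul]
  rw [coeff_subst ha]
  have hfin := coeff_subst_finite ha f e
  simp only [smul_eq_mul] at hfin ⊢
  rw [← tsum_eq_finsum (L := .unconditional _) hfin]
  exact (summable_of_hasFiniteSupport hfin).hasSum

/-- The power `X i ^ k` makes a family summable if every exponent `k` occurs finitely often. -/
lemma summable_X_pow_mul {ι κ : Type*} (i : κ) (k : ι → ℕ) (hk : ∀ N, {j | k j ≤ N}.Finite)
    (g : ι → MvPowerSeries κ ℂ) : Summable fun j => (X i : MvPowerSeries κ ℂ) ^ k j * g j := by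
  rw [WithPiTopology.summable_iff_summable_coeff]
  intro e
  refine summable_of_hasFiniteSupport ((hk (e i)).subset fun j hj => ?_)
  by_contra hlt
  refine hj ?_
  have hlt : e i < k j := not_le.1 hlt
  have h1 : (X i : MvPowerSeries κ ℂ) ^ k j ∣ X i ^ k j * g j := dvd_mul_right _ _
  exact X_pow_dvd_iff.1 h1 e hlt

lemma summable_z_pow_mul (g : ℕ → Series) : Summable fun j => z ^ j * g j :=
  summable_X_pow_mul 0 (fun j => j) (fun N => Set.finite_Iic N) g

lemma summable_w_pow_mul {b : ℕ} (hb : 1 ≤ b) (g : ℕ → Series) :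
    Summable fun j => w ^ (b * j) * g j :=
  summable_X_pow_mul 1 (fun j => b * j)
    (fun N => (Set.finite_Iic N).subset fun j hj => (Nat.le_mul_of_pos_left j hb).trans hj) g

lemma hasSubst_vec {u₀ u₁ u₂ : Series} (h₀ : constantCoeff u₀ = 0) (h₁ : constantCoeff u₁ = 0)
    (h₂ : constantCoeff u₂ = 0) : HasSubst ![u₀, u₁, u₂] := by
  refine hasSubst_of_constantCoeff_zero fun i => ?_
  fin_cases i <;> simp [h₀, h₁, h₂]

/-- The series `genFun b a` at `(b * z, w, u)`, as a sum over its three indices. -/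
lemma hasSum_genFun {b : ℕ} (hb : 1 ≤ b) (a : ℕ → ℕ → ℕ → ℕ) {u : Series}
    (hu : constantCoeff u = 0) :
    HasSum (fun p : (ℕ × ℕ) × ℕ => w ^ (b * p.1.1) * (z ^ p.1.2 *
        (C ((b : ℂ) ^ p.1.2 / (p.1.2.factorial : ℂ)) * (C (a p.1.1 p.1.2 p.2 : ℂ) * u ^ p.2))))
      (at3 (genFun b a) (C (b : ℂ) * z) w u) := by
  have hs : HasSubst ![C (b : ℂ) * z, w, u] :=
    hasSubst_vec (by simp [z]) (by simp [w]) hu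
  have h := hasSum_subst hs (genFun b a)
  let g : (ℕ × ℕ) × ℕ → (Fin 3 →₀ ℕ) := fun p =>
    Finsupp.equivFunOnFinite.symm ![p.1.2, b * p.1.1, p.2]
  have hg : Function.Injective g := by
    rintro ⟨⟨m, n⟩, k⟩ ⟨⟨m', n'⟩, k'⟩ he
    have h0 := DFunLike.congr_fun he 0
    have h1 := DFunLike.congr_fun he 1
    have h2 := DFunLike.congr_fun he 2
    simp only [g, Finsupp.equivFunOnFinite_symm_apply_apply, Matrix.cons_val] at h0 h1 h2
    rw [Nat.eq_of_mul_eq_mul_left hb h1, h0, h2]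
  change HasSum _ (subst ![C (b : ℂ) * z, w, u] (genFun b a))
  rw [← hg.hasSum_iff] at h
  · convert h using 1
    funext p
    have hc : coeff (g p) (genFun b a) =
        (a p.1.1 p.1.2 p.2 : ℂ) / (p.1.2.factorial : ℂ) := by
      change (if b ∣ g p 1 then (a (g p 1 / b) (g p 0) (g p 2) : ℂ) / ((g p 0).factorial : ℂ)
        else 0) = _
      simp only [g, Finsupp.equivFunOnFinite_symm_apply_apply, Matrix.cons_val]
      rw [if_pos (dvd_mul_right _ _), Nat.mul_div_cancel_left _ hb]
    rw [Function.comp_apply, hc, Finsupp.prod_fintype _ _ (fun _ => pow_zero _),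
      Fin.prod_univ_three]
    simp only [g, Finsupp.equivFunOnFinite_symm_apply_apply, Matrix.cons_val, mul_pow, ← map_pow,
      div_eq_mul_inv, map_mul]
    ring
  · intro e he
    have : coeff e (genFun b a) = 0 := by
      change (if b ∣ e 1 then (a (e 1 / b) (e 0) (e 2) : ℂ) / ((e 0).factorial : ℂ) else 0) = 0
      rw [if_neg]
      intro hdvd
      refine he ⟨((e 1 / b, e 0), e 2), ?_⟩
      ext i
      fin_cases i <;> simp [g, Nat.mul_div_cancel' hdvd]
    rw [this, map_zero, zero_mul]

/-- A generating function that counts hash tables with a marked key in bucket `0` by a statistic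
`f` is, for given sizes, a sum over these tables. -/
lemma hasSum_genFun_card {b : ℕ} (hb : 1 ≤ b) (f : ∀ m n : ℕ, (Fin n → Fin m) × Fin n → ℕ)
    {u : Series} (hu : constantCoeff u = 0) :
    HasSum (fun p : ℕ × ℕ => w ^ (b * p.1) * (z ^ p.2 *
        (C ((b : ℂ) ^ p.2 / (p.2.factorial : ℂ)) *
          ∑ t : (Fin p.2 → Fin p.1) × Fin p.2 with (t.1 t.2 : ℕ) = 0, u ^ f p.1 p.2 t)))
      (at3 (genFun b fun m n k => (Finset.univ.filter fun t : (Fin n → Fin m) × Fin n =>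
        (t.1 t.2 : ℕ) = 0 ∧ f m n t = k).card) (C (b : ℂ) * z) w u) := by
  have h₀ := hasSum_genFun hb (fun m n k => (Finset.univ.filter fun t :
    (Fin n → Fin m) × Fin n => (t.1 t.2 : ℕ) = 0 ∧ f m n t = k).card) hu
  refine HasSum.prod_fiberwise h₀ fun p => ?_
  dsimp only
  refine HasSum.mul_left _ (HasSum.mul_left _ (HasSum.mul_left _ ?_))
  have h : ∀ k : ℕ, (C (((Finset.univ.filter fun t : (Fin p.2 → Fin p.1) × Fin p.2 =>
      (t.1 t.2 : ℕ) = 0 ∧ f p.1 p.2 t = k).card : ℕ) : ℂ) * u ^ k : Series) =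
      ∑ t : (Fin p.2 → Fin p.1) × Fin p.2 with (t.1 t.2 : ℕ) = 0,
        if k = f p.1 p.2 t then u ^ f p.1 p.2 t else 0 := by
    intro k
    rw [← Finset.filter_filter, Finset.card_filter, map_natCast, Nat.cast_sum, Finset.sum_mul]
    refine Finset.sum_congr rfl fun t _ => ?_
    by_cases hk : f p.1 p.2 t = k
    · simp [hk]
    · simp [hk, Ne.symm hk]
  simp only [h]
  exact hasSum_sum fun t _ => hasSum_ite_eq _ _

/-- A double series may be summed along the antidiagonals. -/
lemma tsum_antidiagonal {f : ℕ × ℕ → Series} (hf : Summable f)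
    (hf' : ∀ i, Summable fun j => f (i, j)) :
    ∑' n, ∑ p ∈ Finset.HasAntidiagonal.antidiagonal n, f p = ∑' i, ∑' j, f (i, j) := by
  have h1 : HasSum f (∑' i, ∑' j, f (i, j)) := by
    have := hf.hasSum.prod_fiberwise fun i => (hf' i).hasSum
    rw [this.tsum_eq]
    exact hf.hasSum
  have h2 := (Finset.HasAntidiagonal.sigmaAntidiagonalEquivProd (A := ℕ)).hasSum_iff.2 h1
  refine (h2.sigma fun n => ?_).tsum_eq
  have := hasSum_fintype fun p : Finset.HasAntidiagonal.antidiagonal n => f p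
  rw [Finset.sum_coe_sort (Finset.HasAntidiagonal.antidiagonal n) f] at this
  exact this

end Sums

/-! ### From the number of winners to the displacement -/

section RootFilter

lemma omega_isPrimitiveRoot {b : ℕ} (hb : 1 ≤ b) : IsPrimitiveRoot (omega b) b :=
  Complex.isPrimitiveRoot_exp b (by omega)

lemma sum_omega_pow {b : ℕ} (hb : 1 ≤ b) (l : ℕ) :
    ∑ d ∈ Finset.range b, omega b ^ (d * l) = if b ∣ l then (b : ℂ) else 0 := by
  have hω := omega_isPrimitiveRoot hb
  simp only [mul_comm _ l, pow_mul]
  split_ifs with h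
  · rw [(hω.pow_eq_one_iff_dvd l).2 h]; simp
  · have h1 : omega b ^ l ≠ 1 := fun he => h ((hω.pow_eq_one_iff_dvd l).1 he)
    rw [geom_sum_eq h1, ← pow_mul, mul_comm, pow_mul, hω.pow_eq_one, one_pow, sub_self, zero_div]

/-- The exponents `k` and `⌊k / b⌋` are related by a filter over the `b`-th roots of unity. -/
lemma sum_omega_mul_pow {b : ℕ} (hb : 1 ≤ b) (s : Series) (k : ℕ) :
    ∑ d ∈ Finset.range b, C (omega b ^ d) * (∑ i ∈ Finset.range b, (C (omega b ^ d) * s) ^ i) *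
      (C (omega b ^ d) * s) ^ k = C (b : ℂ) * s ^ (b - 1) * (s ^ b) ^ (k / b) := by
  have h1 : ∀ d ∈ Finset.range b, C (omega b ^ d) *
      (∑ i ∈ Finset.range b, (C (omega b ^ d) * s) ^ i) * (C (omega b ^ d) * s) ^ k =
      ∑ i ∈ Finset.range b, C (omega b ^ (d * (k + i + 1))) * s ^ (k + i) := by
    intro d _
    rw [Finset.mul_sum, Finset.sum_mul]
    refine Finset.sum_congr rfl fun i _ => ?_
    rw [mul_pow, mul_pow, pow_mul (omega b) d, map_pow C (omega b ^ d) (k + i + 1)]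
    ring
  rw [Finset.sum_congr rfl h1, Finset.sum_comm]
  simp only [← Finset.sum_mul, ← map_sum, sum_omega_pow hb]
  have hmod := Nat.mod_lt k hb
  have hdiv := Nat.div_add_mod k b
  -- the only `i < b` for which `b` divides `k + i + 1`
  rw [Finset.sum_eq_single (b - 1 - k % b)]
  · rw [if_pos, mul_assoc, ← pow_mul, ← pow_add]
    · congr 2; omega
    · rw [show k + (b - 1 - k % b) + 1 = b * (k / b) + b by omega]
      exact (dvd_mul_right _ _).add dvd_rfl
  · intro i hi hne
    rw [Finset.mem_range] at hi
    rw [if_neg, map_zero, zero_mul]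
    rintro ⟨c, hc⟩
    refine hne ?_
    -- `k % b + i + 1` is a multiple of `b` below `2 * b`
    have h2 : k % b + i + 1 = b * (c - k / b) := by
      rw [Nat.mul_sub]; omega
    have h3 : c - k / b = 1 := by
      rcases Nat.lt_trichotomy (c - k / b) 1 with h4 | h4 | h4
      · rw [Nat.lt_one_iff.1 h4] at h2; omega
      · exact h4
      · have := Nat.mul_le_mul_left b h4; omega
    rw [h3] at h2
    omega
  · intro hni
    exact absurd (Finset.mem_range.2 (by omega)) hni

lemma countRH_eq (b : ℕ) (σ : InsertionOrders) (m n k : ℕ) :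
    countRH b σ m n k = (Finset.univ.filter fun t : (Fin n → Fin m) × Fin n =>
      (t.1 t.2 : ℕ) = 0 ∧ cRH b t.1 (σ m n t.1) t.2 / b = k).card := by
  rw [countRH]
  congr 1
  refine Finset.filter_congr fun t _ => and_congr_right fun ht => ?_
  rw [dRH_eq _ ht]

/-- The first identity, with denominators cleared. -/
theorem sum_CGF_eq {b : ℕ} (hb : 1 ≤ b) (σ : InsertionOrders) {s : Series}
    (hs : constantCoeff s = 0) :
    ∑ d ∈ Finset.range b, C (omega b ^ d) *
        (∑ i ∈ Finset.range b, (C (omega b ^ d) * s) ^ i) *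
        at3 (CGF b σ) (C (b : ℂ) * z) w (C (omega b ^ d) * s) =
      C (b : ℂ) * s ^ (b - 1) * at3 (RH b σ) (C (b : ℂ) * z) w (s ^ b) := by
  have hC := fun d (_ : d ∈ Finset.range b) => (hasSum_genFun_card hb
    (fun m n t => cRH b t.1 (σ m n t.1) t.2) (u := C (omega b ^ d) * s) (by simp [hs])).mul_left
      (C (omega b ^ d) * (∑ i ∈ Finset.range b, (C (omega b ^ d) * s) ^ i))
  have hR := (hasSum_genFun_card hb
    (fun m n t => cRH b t.1 (σ m n t.1) t.2 / b) (u := s ^ b)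
      (by rw [map_pow, hs, zero_pow (by omega)])).mul_left (C (b : ℂ) * s ^ (b - 1))
  have hRH : RH b σ = genFun b fun m n k => (Finset.univ.filter fun t :
      (Fin n → Fin m) × Fin n => (t.1 t.2 : ℕ) = 0 ∧ cRH b t.1 (σ m n t.1) t.2 / b = k).card := by
    rw [RH]
    congr 1
    funext m n k
    exact countRH_eq b σ m n k
  rw [hRH]
  refine (hasSum_sum hC).unique ?_
  convert hR using 1
  funext p
  have hcomm : ∀ {β : Type} (T : Finset β) (K : ℕ → Series) (U : ℕ → β → Series) (A B D : Series),
      ∑ d ∈ Finset.range b, K d * (A * (B * (D * ∑ t ∈ T, U d t))) =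
        A * (B * (D * ∑ t ∈ T, ∑ d ∈ Finset.range b, K d * U d t)) := by
    intro β T K U A B D
    simp only [Finset.mul_sum]
    rw [Finset.sum_comm]
    refine Finset.sum_congr rfl fun t _ => Finset.sum_congr rfl fun d _ => ?_
    ring
  rw [hcomm]
  simp only [sum_omega_mul_pow hb]
  rw [← Finset.mul_sum]
  ring

lemma toFrac_eq_zero {f : Series} : toFrac f = 0 ↔ f = 0 :=
  IsFractionRing.to_map_eq_zero_iff

lemma toFrac_mul (f g : Series) : toFrac (f * g) = toFrac f * toFrac g := map_mul _ _ _

lemma toFrac_pow (f : Series) (k : ℕ) : toFrac (f ^ k) = toFrac f ^ k := map_pow _ _ _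

lemma toFrac_sum {β : Type*} (I : Finset β) (f : β → Series) :
    toFrac (∑ i ∈ I, f i) = ∑ i ∈ I, toFrac (f i) := map_sum _ _ _

lemma q_ne_zero : q ≠ 0 := fun h => by
  have := congrArg (coeff (Finsupp.single 2 1)) h
  rw [q, X, coeff_monomial_same] at this
  simp at this

lemma C_ne_zero {a : ℂ} (ha : a ≠ 0) : (C a : Series) ≠ 0 := fun h => ha (by
  have := congrArg constantCoeff h
  simpa using this)

theorem RH_eq_sum {b : ℕ} (hb : 1 ≤ b) (σ : InsertionOrders) :
    toFrac (at3 (RH b σ) (C (b : ℂ) * z) w (q ^ b)) =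
      1 / (b : Frac) * ∑ d ∈ Finset.range b,
        toFrac (at3 (CGF b σ) (C (b : ℂ) * z) w (C (omega b ^ d) * q)) *
          ∑ p ∈ Finset.range b, toFrac (C (omega b ^ d) * q) ^ (-(p : ℤ)) := by
  have hω := omega_isPrimitiveRoot hb
  have hbF : (b : Frac) = toFrac (C (b : ℂ)) := by
    rw [toFrac, map_natCast, map_natCast]
  have hb0 : toFrac (C (b : ℂ)) ≠ 0 := fun h =>
    C_ne_zero (Nat.cast_ne_zero.2 (by omega)) (toFrac_eq_zero.1 h)
  have hqb : toFrac (q ^ (b - 1)) ≠ 0 := fun h => pow_ne_zero _ q_ne_zero (toFrac_eq_zero.1 h)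
  have hinv : ∀ d, ∑ p ∈ Finset.range b, toFrac (C (omega b ^ d) * q) ^ (-(p : ℤ)) =
      toFrac (C (omega b ^ d) * ∑ i ∈ Finset.range b, (C (omega b ^ d) * q) ^ i) /
        toFrac (q ^ (b - 1)) := by
    intro d
    have ht : toFrac (C (omega b ^ d) * q) ≠ 0 := fun h =>
      mul_ne_zero (C_ne_zero (pow_ne_zero _ (hω.ne_zero (by omega)))) q_ne_zero
        (toFrac_eq_zero.1 h)
    have h1 : C (omega b ^ d) * (C (omega b ^ d) * q) ^ (b - 1) = q ^ (b - 1) := by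
      rw [mul_pow, ← mul_assoc, ← pow_succ', Nat.sub_add_cancel hb, ← map_pow, ← pow_mul,
        mul_comm d, pow_mul, hω.pow_eq_one, one_pow, map_one, one_mul]
    generalize C (omega b ^ d) * q = t at ht h1 ⊢
    rw [eq_div_iff hqb, Finset.sum_mul, ← Finset.sum_range_reflect, toFrac_mul, toFrac_sum,
      Finset.mul_sum]
    refine Finset.sum_congr rfl fun i hi => ?_
    rw [Finset.mem_range] at hi
    have h2 : toFrac t ^ (b - 1) = toFrac t ^ (b - 1 - i) * toFrac t ^ i := by
      rw [← pow_add]; congr 1; omega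
    rw [← h1, toFrac_mul, toFrac_pow, toFrac_pow, h2, zpow_neg, zpow_natCast]
    field_simp
  have hmain := congrArg toFrac (sum_CGF_eq hb σ (s := q) (by simp [q]))
  rw [toFrac_sum, toFrac_mul, toFrac_mul] at hmain
  have hsum : ∑ d ∈ Finset.range b,
        toFrac (at3 (CGF b σ) (C (b : ℂ) * z) w (C (omega b ^ d) * q)) *
          ∑ p ∈ Finset.range b, toFrac (C (omega b ^ d) * q) ^ (-(p : ℤ)) =
      (toFrac (C (b : ℂ)) * toFrac (q ^ (b - 1)) *
        toFrac (at3 (RH b σ) (C (b : ℂ) * z) w (q ^ b))) / toFrac (q ^ (b - 1)) := by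
    rw [← hmain, Finset.sum_div]
    refine Finset.sum_congr rfl fun d _ => ?_
    rw [hinv, toFrac_mul _ (at3 _ _ _ _)]
    ring
  rw [hsum, hbF]
  field_simp

end RootFilter

/-! ### Sums over hash functions -/

section HashSum

/-- The sum of `f x` over all ways to hash `n` keys to the buckets in `I`, where `x i` is the number
of keys that hash to bucket `i`. -/
def hashSum (I : Finset ℕ) : ℕ → ((ℕ → ℕ) → Series) → Series
  | 0, f => f 0
  | n + 1, f => ∑ c ∈ I, hashSum I n fun x => f (x + Pi.single c 1)

lemma hashSum_add (I : Finset ℕ) (n : ℕ) (f g : (ℕ → ℕ) → Series) :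
    hashSum I n (fun x => f x + g x) = hashSum I n f + hashSum I n g := by
  induction n generalizing f g with
  | zero => rfl
  | succ n ih => simp only [hashSum, ih, Finset.sum_add_distrib]

lemma hashSum_mul_left (I : Finset ℕ) (n : ℕ) (a : Series) (f : (ℕ → ℕ) → Series) :
    hashSum I n (fun x => a * f x) = a * hashSum I n f := by
  induction n generalizing f with
  | zero => rfl
  | succ n ih => simp only [hashSum, ih, Finset.mul_sum]

lemma hashSum_congr {I : Finset ℕ} (n : ℕ) {f g : (ℕ → ℕ) → Series}
    (h : ∀ x, (∀ c ∉ I, x c = 0) → f x = g x) : hashSum I n f = hashSum I n g := by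
  induction n generalizing f g with
  | zero => exact h 0 fun _ _ => rfl
  | succ n ih =>
    refine Finset.sum_congr rfl fun c hc => ih fun x hx => h _ fun d hd => ?_
    rw [Pi.add_apply, hx d hd, Pi.single_eq_of_ne (by rintro rfl; exact hd hc), add_zero]

/-- The keys that hash to one bucket can be chosen first. -/
lemma hashSum_insert {I : Finset ℕ} {a : ℕ} (ha : a ∉ I) (n : ℕ) (f : (ℕ → ℕ) → Series) :
    hashSum (insert a I) n f = ∑ p ∈ Finset.HasAntidiagonal.antidiagonal n,
      (n.choose p.1 : Series) * hashSum I p.2 fun x => f (x + Pi.single a p.1) := by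
  induction n generalizing f with
  | zero => simp [hashSum]
  | succ n ih =>
    rw [Finset.sum_antidiagonal_choose_succ_mul
      (fun i j : ℕ => hashSum I j fun x => f (x + (Pi.single a i : ℕ → ℕ))), hashSum,
      Finset.sum_insert ha, add_comm]
    congr 1
    · simp only [ih]
      rw [Finset.sum_comm]
      refine Finset.sum_congr rfl fun p _ => ?_
      simp only [hashSum, Finset.mul_sum, add_right_comm _ (Pi.single a p.1 : ℕ → ℕ)]
    · rw [ih]
      refine Finset.sum_congr rfl fun p hp => ?_
      rw [← Finset.HasAntidiagonal.mem_antidiagonal.1 hp, Nat.choose_symm_add]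
      simp only [add_assoc, ← Pi.single_add]

lemma hashCount_cons {m n : ℕ} (c : Fin m) (h : Fin n → Fin m) :
    hashCount (Fin.cons c h : Fin (n + 1) → Fin m) = hashCount h + Pi.single (c : ℕ) 1 := by
  funext i
  simp only [hashCount, Finset.card_filter, Fin.sum_univ_succ, Fin.cons_zero, Fin.cons_succ,
    Pi.add_apply, Pi.single_apply, eq_comm (a := i)]
  rw [add_comm]

lemma sum_hashCount (m n : ℕ) (f : (ℕ → ℕ) → Series) :
    ∑ h : Fin n → Fin m, f (hashCount h) = hashSum (Finset.range m) n f := by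
  induction n generalizing f with
  | zero =>
    rw [Fintype.sum_unique, hashSum]
    congr 1
  | succ n ih =>
    rw [← (Fin.consEquiv fun _ : Fin (n + 1) => Fin m).sum_comp, Fintype.sum_prod_type, hashSum,
      Finset.sum_range]
    refine Finset.sum_congr rfl fun c _ => ?_
    rw [← ih]
    refine Finset.sum_congr rfl fun h _ => ?_
    rw [← hashCount_cons]
    rfl

/-- The exponential generating function of `hashSum`, in the variable `b * z`. -/
noncomputable def hashGF (b : ℕ) (I : Finset ℕ) (f : (ℕ → ℕ) → Series) : Series :=
  ∑' n, z ^ n * (C ((b : ℂ) ^ n / (n.factorial : ℂ)) * hashSum I n f)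

variable {b : ℕ}

lemma hashGF_add (I : Finset ℕ) (f g : (ℕ → ℕ) → Series) :
    hashGF b I (fun x => f x + g x) = hashGF b I f + hashGF b I g := by
  rw [hashGF, hashGF, hashGF, ← (summable_z_pow_mul _).tsum_add (summable_z_pow_mul _)]
  simp only [hashSum_add, mul_add]

lemma hashGF_mul_left (I : Finset ℕ) (a : Series) (f : (ℕ → ℕ) → Series) :
    hashGF b I (fun x => a * f x) = a * hashGF b I f := by
  rw [hashGF, hashGF, ← (summable_z_pow_mul _).tsum_mul_left]
  simp only [hashSum_mul_left]
  congr 1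
  funext n
  ring

lemma hashGF_sum (I : Finset ℕ) {β : Type*} (J : Finset β) (f : β → (ℕ → ℕ) → Series) :
    hashGF b I (fun x => ∑ s ∈ J, f s x) = ∑ s ∈ J, hashGF b I (f s) := by
  classical
  induction J using Finset.induction_on with
  | empty =>
    have := hashGF_mul_left (b := b) I 0 (fun _ => 0)
    simpa using this
  | insert s J hs ih =>
    simp only [Finset.sum_insert hs]
    rw [hashGF_add, ih]

lemma hashGF_empty (f : (ℕ → ℕ) → Series) : hashGF b ∅ f = f 0 := by
  rw [hashGF, tsum_eq_single 0]
  · simp [hashSum]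
  · intro n hn
    obtain ⟨k, rfl⟩ := Nat.exists_eq_succ_of_ne_zero hn
    simp [hashSum]

lemma hasSum_exp {u : Series} (hu : constantCoeff u = 0) :
    HasSum (fun n : ℕ => C (1 / (n.factorial : ℂ)) * u ^ n) (at1 (PowerSeries.exp ℂ) u) := by
  have h := hasSum_subst (PowerSeries.HasSubst.of_constantCoeff_zero hu).const (PowerSeries.exp ℂ)
  change HasSum _ (subst (fun _ => u) (PowerSeries.exp ℂ))
  rw [← (Finsupp.uniqueEquiv (M := ℕ) ()).symm.hasSum_iff] at h
  convert h using 1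
  funext n
  have he : (Finsupp.uniqueEquiv (M := ℕ) ()).symm n = Finsupp.single () n := by
    ext; simp
  have hc : coeff (Finsupp.single () n) (PowerSeries.exp ℂ) = 1 / (n.factorial : ℂ) := by
    have := PowerSeries.coeff_exp (A := ℂ) n
    rw [PowerSeries.coeff] at this
    rw [this]
    simp
  rw [Function.comp_apply, he, hc, Finsupp.prod_single_index (h := fun _ k => u ^ k) (pow_zero u)]

/-- If a key that hashes to bucket `a` just multiplies the weight by `t`, the bucket contributes a
factor `exp (b * z * t)`. -/
lemma hashGF_insert {I : Finset ℕ} {a : ℕ} (ha : a ∉ I) {f g : (ℕ → ℕ) → Series} (t : Series)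
    (h : ∀ x, (∀ c ∉ I, x c = 0) → ∀ i, f (x + Pi.single a i) = t ^ i * g x) :
    hashGF b (insert a I) f = at1 (PowerSeries.exp ℂ) (C (b : ℂ) * z * t) * hashGF b I g := by
  let F : ℕ × ℕ → Series := fun p => z ^ (p.1 + p.2) *
    (C ((b : ℂ) ^ p.1 / (p.1.factorial : ℂ)) * t ^ p.1 *
      (C ((b : ℂ) ^ p.2 / (p.2.factorial : ℂ)) * hashSum I p.2 g))
  have hF : Summable F := by
    refine summable_X_pow_mul 0 (fun p : ℕ × ℕ => p.1 + p.2) (fun N => ?_) _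
    refine ((Set.finite_Iic N).prod (Set.finite_Iic N)).subset fun p hp => ?_
    have : p.1 + p.2 ≤ N := hp
    exact ⟨by simp; omega, by simp; omega⟩
  have hF' : ∀ i j, F (i, j) = C (1 / (i.factorial : ℂ)) * (C (b : ℂ) * z * t) ^ i *
      (z ^ j * (C ((b : ℂ) ^ j / (j.factorial : ℂ)) * hashSum I j g)) := by
    intro i j
    simp only [F, mul_pow, pow_add, div_eq_mul_inv, map_mul, map_pow, one_mul]
    ring
  have h1 : hashGF b (insert a I) f = ∑' n, ∑ p ∈ Finset.HasAntidiagonal.antidiagonal n, F p := by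
    rw [hashGF]
    congr 1
    funext n
    rw [hashSum_insert ha, Finset.mul_sum, Finset.mul_sum]
    refine Finset.sum_congr rfl fun p hp => ?_
    rw [hashSum_congr _ (fun x hx => h x hx p.1), hashSum_mul_left]
    have hpn := Finset.HasAntidiagonal.mem_antidiagonal.1 hp
    have hc : (b : ℂ) ^ n / (n.factorial : ℂ) * (n.choose p.1 : ℂ) =
        (b : ℂ) ^ p.1 / (p.1.factorial : ℂ) * ((b : ℂ) ^ p.2 / (p.2.factorial : ℂ)) := by
      have h0 : (n.factorial : ℂ) ≠ 0 := Nat.cast_ne_zero.2 n.factorial_ne_zero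
      have h1 : (p.1.factorial : ℂ) ≠ 0 := Nat.cast_ne_zero.2 p.1.factorial_ne_zero
      have h2 : (p.2.factorial : ℂ) ≠ 0 := Nat.cast_ne_zero.2 p.2.factorial_ne_zero
      have h3 : (n.factorial : ℂ) = n.choose p.1 * p.1.factorial * p.2.factorial := by
        rw [← Nat.choose_mul_factorial_mul_factorial (show p.1 ≤ n by omega),
          show n - p.1 = p.2 by omega]
        push_cast; ring
      rw [← hpn, pow_add, hpn, div_mul_div_comm, div_mul_eq_mul_div, div_eq_div_iff h0
        (mul_ne_zero h1 h2), h3]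
      ring
    have hc' : (C ((b : ℂ) ^ n / (n.factorial : ℂ)) : Series) * (n.choose p.1 : Series) =
        C ((b : ℂ) ^ p.1 / (p.1.factorial : ℂ)) * C ((b : ℂ) ^ p.2 / (p.2.factorial : ℂ)) := by
      rw [← map_mul, ← hc, map_mul, map_natCast]
    simp only [F]
    rw [hpn, ← mul_assoc (C ((b : ℂ) ^ n / (n.factorial : ℂ))), hc']
    ring
  have hexp := hasSum_exp (u := C (b : ℂ) * z * t) (by simp [z])
  rw [h1, tsum_antidiagonal hF]
  · simp only [hF', (summable_z_pow_mul _).tsum_mul_left]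
    rw [hexp.summable.tsum_mul_right, hexp.tsum_eq, hashGF]
  · intro i
    simp only [hF']
    exact (summable_z_pow_mul _).mul_left _

end HashSum

/-! ### The overflow of a line of buckets -/

section Overflow

/-- The overflow from bucket `i` when `x j` keys hash to bucket `j`, for `1 ≤ j ≤ i`. -/
def lineOverflow (b : ℕ) (x : ℕ → ℕ) : ℕ → ℕ
  | 0 => 0
  | i + 1 => lineOverflow b x i + x (i + 1) - b

lemma linearOverflow_eq {m n : ℕ} (b : ℕ) (h : Fin n → Fin m) (i : ℕ) :
    linearOverflow b h i = lineOverflow b (hashCount h) i := by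
  induction i with
  | zero => rfl
  | succ i ih => rw [linearOverflow, lineOverflow, ih]

lemma lineOverflow_congr {b : ℕ} {x y : ℕ → ℕ} {i : ℕ} (h : ∀ j ∈ Finset.Icc 1 i, x j = y j) :
    lineOverflow b x i = lineOverflow b y i := by
  induction i with
  | zero => rfl
  | succ i ih =>
    rw [lineOverflow, lineOverflow, h (i + 1) (by simp),
      ih fun j hj => h j (by rw [Finset.mem_Icc] at hj ⊢; omega)]

lemma lineOverflow_add_single {b i a : ℕ} (ha : a ∉ Finset.Icc 1 i) (x : ℕ → ℕ) (k : ℕ) :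
    lineOverflow b (x + Pi.single a k) i = lineOverflow b x i :=
  lineOverflow_congr fun j hj => by
    rw [Pi.add_apply, Pi.single_eq_of_ne (by rintro rfl; exact ha hj), add_zero]

/-- The generating function of the overflow from a line of `m` buckets. -/
noncomputable def overflowGF (b m : ℕ) : Series :=
  hashGF b (Finset.Icc 1 m) fun x => q ^ lineOverflow b x m

/-- The generating function of the tables in which exactly `s` keys try the last of `m + 1`
buckets in a line. -/
noncomputable def lastBucketGF (b m s : ℕ) : Series :=
  hashGF b (Finset.Icc 1 (m + 1)) fun x => if lineOverflow b x m + x (m + 1) = s then 1 else 0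

/-- The generating function of the overflow from lines of buckets of all lengths. -/
noncomputable def allOverflowGF (b : ℕ) : Series := ∑' m, w ^ (b * m) * overflowGF b m

/-- The generating function of the nonempty lines of buckets in which exactly `s` keys try the last
bucket. A line of `m + 1` buckets has the weight `w ^ (b * m)`. -/
noncomputable def allLastBucketGF (b s : ℕ) : Series := ∑' m, w ^ (b * m) * lastBucketGF b m s

lemma overflowGF_zero (b : ℕ) : overflowGF b 0 = 1 := by
  rw [overflowGF, Finset.Icc_eq_empty (by norm_num), hashGF_empty, lineOverflow, pow_zero]

lemma insert_Icc_succ (m : ℕ) : insert (m + 1) (Finset.Icc 1 m) = Finset.Icc 1 (m + 1) := by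
  ext i; simp only [Finset.mem_insert, Finset.mem_Icc]; omega

/-- If `y` keys try the last bucket, `y - b` overflow. The terms with `y < b` correct for the
truncated subtraction. -/
lemma q_pow_mul_overflowGF_succ (b m : ℕ) :
    q ^ b * overflowGF b (m + 1) =
      at1 (PowerSeries.exp ℂ) (C (b : ℂ) * z * q) * overflowGF b m +
        ∑ s ∈ Finset.range b, (q ^ b - q ^ s) * lastBucketGF b m s := by
  have hm : m + 1 ∉ Finset.Icc 1 m := by simp
  rw [overflowGF, overflowGF, ← hashGF_insert (a := m + 1)
    (f := fun x => q ^ (lineOverflow b x m + x (m + 1))) hm q, insert_Icc_succ,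
    ← hashGF_mul_left]
  · simp only [lastBucketGF, ← hashGF_mul_left]
    rw [← hashGF_sum, ← hashGF_add]
    congr 1
    funext x
    rw [lineOverflow, ← pow_add]
    rcases lt_or_ge (lineOverflow b x m + x (m + 1)) b with hlt | hge
    · rw [Finset.sum_eq_single_of_mem _ (Finset.mem_range.2 hlt), if_pos rfl,
        Nat.sub_eq_zero_of_le hlt.le]
      · ring
      · intro s _ hs
        rw [if_neg (Ne.symm hs), mul_zero]
    · rw [Finset.sum_eq_zero, Nat.add_sub_cancel' hge, add_zero]
      intro s hs
      rw [Finset.mem_range] at hs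
      rw [if_neg (by omega), mul_zero]
  · intro x hx i
    rw [lineOverflow_add_single hm, Pi.add_apply, hx _ hm, Pi.single_eq_same, zero_add, pow_add,
      mul_comm]

/-- The kernel equation. -/
theorem allOverflowGF_mul_kernel {b : ℕ} (hb : 1 ≤ b) :
    allOverflowGF b * (q ^ b - w ^ b * at1 (PowerSeries.exp ℂ) (C (b : ℂ) * z * q)) =
      q ^ b + ∑ s ∈ Finset.range b, (q ^ b - q ^ s) * (w ^ b * allLastBucketGF b s) := by
  set e : Series := at1 (PowerSeries.exp ℂ) (C (b : ℂ) * z * q)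
  have h1 : q ^ b * allOverflowGF b = q ^ b + ∑' m, w ^ (b * (m + 1)) *
      (q ^ b * overflowGF b (m + 1)) := by
    rw [allOverflowGF, (summable_w_pow_mul hb _).tsum_eq_zero_add, mul_add, mul_zero, pow_zero,
      overflowGF_zero, one_mul, mul_one, ← Summable.tsum_mul_left]
    · congr 2
      funext m
      ring
    · exact (summable_nat_add_iff 1).2 (summable_w_pow_mul hb (overflowGF b))
  have h2 : ∀ m, w ^ (b * (m + 1)) * (q ^ b * overflowGF b (m + 1)) =
      w ^ b * e * (w ^ (b * m) * overflowGF b m) +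
        ∑ s ∈ Finset.range b, (q ^ b - q ^ s) * w ^ b * (w ^ (b * m) * lastBucketGF b m s) := by
    intro m
    rw [q_pow_mul_overflowGF_succ, mul_add, Finset.mul_sum]
    congr 1
    · ring
    · refine Finset.sum_congr rfl fun s _ => ?_
      ring
  have h3 : ∀ s ∈ Finset.range b, Summable fun m =>
      (q ^ b - q ^ s) * w ^ b * (w ^ (b * m) * lastBucketGF b m s) :=
    fun s _ => (summable_w_pow_mul hb _).mul_left _
  simp only [h2] at h1
  rw [Summable.tsum_add ((summable_w_pow_mul hb _).mul_left _) (summable_sum h3),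
    Summable.tsum_finsetSum h3, (summable_w_pow_mul hb _).tsum_mul_left] at h1
  have h4 : ∀ s, ∑' m, (q ^ b - q ^ s) * w ^ b * (w ^ (b * m) * lastBucketGF b m s) =
      (q ^ b - q ^ s) * (w ^ b * allLastBucketGF b s) := by
    intro s
    rw [(summable_w_pow_mul hb _).tsum_mul_left, allLastBucketGF, mul_assoc]
  simp only [h4] at h1
  rw [← allOverflowGF] at h1
  linear_combination h1

/-- The ranks in a finite set are `0, 1, …, card - 1`. -/
lemma one_sub_mul_sum_pow_rank {n : ℕ} (Z : Finset (Fin n)) (t : Series) :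
    (1 - t) * ∑ x ∈ Z, t ^ (Z.filter fun y => y < x).card = 1 - t ^ Z.card := by
  induction Z using Finset.induction_on_max with
  | empty => simp
  | insert a Z ha ih =>
    have haZ : a ∉ Z := fun h => lt_irrefl a (ha a h)
    rw [Finset.sum_insert haZ, mul_add, Finset.card_insert_of_notMem haZ]
    have h1 : ((insert a Z).filter fun y => y < a) = Z := by
      ext y
      simp only [Finset.mem_filter, Finset.mem_insert]
      exact ⟨fun h => h.1.resolve_left h.2.ne, fun h => ⟨.inr h, ha y h⟩⟩
    have h2 : ∀ x ∈ Z, ((insert a Z).filter fun y => y < x) = Z.filter fun y => y < x := by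
      intro x hx
      rw [Finset.filter_insert, if_neg (ha x hx).not_gt]
    rw [h1, Finset.sum_congr rfl fun x hx => by rw [h2 x hx], ih]
    ring

/-- The contribution of the tables with `m + 1` buckets and `n` keys. -/
lemma one_sub_q_mul_sum_cRH (b : ℕ) (σ : InsertionOrders) (m n : ℕ) :
    (1 - q) * ∑ t : (Fin n → Fin (m + 1)) × Fin n with (t.1 t.2 : ℕ) = 0,
        q ^ cRH b t.1 (σ (m + 1) n t.1) t.2 =
      hashSum (insert 0 (Finset.Icc 1 m)) n fun x => q ^ lineOverflow b x m * (1 - q ^ x 0) := by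
  have hI : insert 0 (Finset.Icc 1 m) = Finset.range (m + 1) := by
    ext i; simp only [Finset.mem_insert, Finset.mem_Icc, Finset.mem_range]; omega
  rw [hI, ← sum_hashCount, Finset.sum_filter, Fintype.sum_prod_type, Finset.mul_sum]
  refine Finset.sum_congr rfl fun h _ => ?_
  rw [← Finset.sum_filter]
  simp only [cRH_eq, linearOverflow_eq, Nat.add_sub_cancel, pow_add]
  rw [← Finset.mul_sum, mul_left_comm]
  congr 1
  have := one_sub_mul_sum_pow_rank (Finset.univ.filter fun y : Fin n => (h y : ℕ) = 0) q
  simp only [Finset.filter_filter] at this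
  exact this

/-- Bucket `0` and the line of the other buckets are independent. -/
theorem one_sub_q_mul_CGF {b : ℕ} (hb : 1 ≤ b) (σ : InsertionOrders) :
    (1 - q) * at3 (CGF b σ) (C (b : ℂ) * z) w q =
      w ^ b * (at1 (PowerSeries.exp ℂ) (C (b : ℂ) * z) -
        at1 (PowerSeries.exp ℂ) (C (b : ℂ) * z * q)) * allOverflowGF b := by
  have h1 := (hasSum_genFun_card hb
    (fun m n t => cRH b t.1 (σ m n t.1) t.2) (u := q) (by simp [q])).mul_left (1 - q)
  have h0 : ∀ m, (0 : ℕ) ∉ Finset.Icc 1 m := by simp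
  have hGF : ∀ m, (hashGF b (insert 0 (Finset.Icc 1 m)) fun x =>
      q ^ lineOverflow b x m * (1 - q ^ x 0)) =
      (at1 (PowerSeries.exp ℂ) (C (b : ℂ) * z) -
        at1 (PowerSeries.exp ℂ) (C (b : ℂ) * z * q)) * overflowGF b m := by
    intro m
    have h2 : hashGF b (insert 0 (Finset.Icc 1 m)) (fun x => q ^ lineOverflow b x m) =
        at1 (PowerSeries.exp ℂ) (C (b : ℂ) * z * 1) * overflowGF b m :=
      hashGF_insert (h0 m) 1 fun x _ i => by
        rw [lineOverflow_add_single (h0 m), one_pow, one_mul]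
    have h3 : hashGF b (insert 0 (Finset.Icc 1 m)) (fun x => q ^ x 0 * q ^ lineOverflow b x m) =
        at1 (PowerSeries.exp ℂ) (C (b : ℂ) * z * q) * overflowGF b m :=
      hashGF_insert (h0 m) q fun x hx i => by
        rw [lineOverflow_add_single (h0 m), Pi.add_apply, hx _ (h0 m), Pi.single_eq_same, zero_add]
    rw [mul_one] at h2
    have h4 := hashGF_mul_left (b := b) (insert 0 (Finset.Icc 1 m)) (-1)
      (fun x => q ^ x 0 * q ^ lineOverflow b x m)
    rw [sub_mul, ← h2, ← h3, sub_eq_add_neg, neg_eq_neg_one_mul, ← h4, ← hashGF_add]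
    congr 1
    funext x
    ring
  have h5 := h1.prod_fiberwise (g := fun m => w ^ (b * m) * ∑' n, z ^ n *
    (C ((b : ℂ) ^ n / (n.factorial : ℂ)) * ((1 - q) *
      ∑ t : (Fin n → Fin m) × Fin n with (t.1 t.2 : ℕ) = 0, q ^ cRH b t.1 (σ m n t.1) t.2)))
    fun m => by
      convert ((summable_z_pow_mul fun n => C ((b : ℂ) ^ n / (n.factorial : ℂ)) * ((1 - q) *
        ∑ t : (Fin n → Fin m) × Fin n with (t.1 t.2 : ℕ) = 0,
          q ^ cRH b t.1 (σ m n t.1) t.2)).hasSum.mul_left (w ^ (b * m))) using 1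
      funext n
      ring
  refine h5.tsum_eq.symm.trans ?_
  rw [(summable_w_pow_mul hb _).tsum_eq_zero_add]
  have h6 : ∀ n, (Finset.univ.filter fun t : (Fin n → Fin 0) × Fin n => (t.1 t.2 : ℕ) = 0) = ∅ :=
    fun n => Finset.eq_empty_of_forall_notMem fun t => (t.1 t.2).elim0
  simp only [h6, Finset.sum_empty, mul_zero, tsum_zero, zero_add, one_sub_q_mul_sum_cRH]
  have h7 : ∀ I f, (∑' n, z ^ n * (C ((b : ℂ) ^ n / (n.factorial : ℂ)) * hashSum I n f)) =
      hashGF b I f := fun _ _ => rfl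
  simp only [h7, hGF]
  rw [allOverflowGF, ← (summable_w_pow_mul hb _).tsum_mul_left]
  congr 1
  funext m
  ring

end Overflow

/-! ### The kernel method -/

section Kernel

/-- The power series does not involve the variable `q`. -/
def FreeOfQ (f : Series) : Prop := ∀ e : Fin 3 →₀ ℕ, e 2 ≠ 0 → coeff e f = 0

lemma freeOfQ_C (a : ℂ) : FreeOfQ (C a) := fun e he => by
  rw [coeff_C, if_neg]
  rintro rfl
  exact he rfl

lemma FreeOfQ.mul {f g : Series} (hf : FreeOfQ f) (hg : FreeOfQ g) : FreeOfQ (f * g) := by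
  intro e he
  classical
  rw [coeff_mul]
  refine Finset.sum_eq_zero fun p hp => ?_
  rw [← Finset.HasAntidiagonal.mem_antidiagonal.1 hp, Finsupp.add_apply] at he
  by_cases h1 : p.1 2 = 0
  · rw [hg p.2 (by omega), mul_zero]
  · rw [hf p.1 h1, zero_mul]

lemma freeOfQ_X_pow {i : Fin 3} (hi : i ≠ 2) (k : ℕ) : FreeOfQ (X i ^ k) := fun e he => by
  classical
  rw [coeff_X_pow, if_neg]
  rintro rfl
  exact he (Finsupp.single_eq_of_ne' hi)

lemma FreeOfQ.sum {β : Type*} {J : Finset β} {f : β → Series} (hf : ∀ i ∈ J, FreeOfQ (f i)) :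
    FreeOfQ (∑ i ∈ J, f i) := fun e he => by
  rw [map_sum]
  exact Finset.sum_eq_zero fun i hi => hf i hi e he

lemma FreeOfQ.tsum {f : ℕ → Series} (hs : Summable f) (hf : ∀ i, FreeOfQ (f i)) :
    FreeOfQ (∑' i, f i) := fun e he => by
  rw [hs.map_tsum (coeff e) (WithPiTopology.continuous_coeff ℂ e)]
  simp [hf _ e he]

lemma FreeOfQ.hashSum {I : Finset ℕ} (n : ℕ) {f : (ℕ → ℕ) → Series} (hf : ∀ x, FreeOfQ (f x)) :
    FreeOfQ (hashSum I n f) := by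
  induction n generalizing f with
  | zero => exact hf 0
  | succ n ih => exact .sum fun c _ => ih fun x => hf _

lemma freeOfQ_allLastBucketGF {b : ℕ} (hb : 1 ≤ b) (s : ℕ) : FreeOfQ (allLastBucketGF b s) := by
  refine .tsum (summable_w_pow_mul hb _) fun m => (freeOfQ_X_pow (by decide) _).mul ?_
  refine .tsum (summable_z_pow_mul _) fun n => (freeOfQ_X_pow (by decide) _).mul ?_
  refine (freeOfQ_C _).mul (.hashSum n fun x => ?_)
  split_ifs
  · exact map_one (C (σ := Fin 3) (R := ℂ)) ▸ freeOfQ_C 1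
  · exact map_zero (C (σ := Fin 3) (R := ℂ)) ▸ freeOfQ_C 0

lemma constantCoeff_z : constantCoeff z = 0 := constantCoeff_X _

lemma constantCoeff_w : constantCoeff w = 0 := constantCoeff_X _

/-- Substitution for `q` does not affect series that do not involve `q`. -/
lemma FreeOfQ.subst_eq {f u : Series} (hf : FreeOfQ f) (hu : constantCoeff u = 0) :
    subst ![z, w, u] f = f := by
  have h1 : HasSubst ![z, w, u] := hasSubst_vec constantCoeff_z constantCoeff_w hu
  have h2 : HasSubst (X : Fin 3 → Series) :=
    hasSubst_of_constantCoeff_zero fun i => constantCoeff_X i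
  conv_rhs => rw [← id_eq f, ← subst_self (R := ℂ)]
  ext e
  rw [coeff_subst h1, coeff_subst h2]
  refine finsum_congr fun d => ?_
  by_cases hd : d 2 = 0
  · rw [Finsupp.prod_fintype _ _ (fun _ => pow_zero _), Finsupp.prod_fintype _ _
      (fun _ => pow_zero _), Fin.prod_univ_three, Fin.prod_univ_three, hd]
    rfl
  · rw [hf d hd, zero_smul, zero_smul]

lemma at1_mul (f g : PowerSeries ℂ) {u : Series} (hu : constantCoeff u = 0) :
    at1 (f * g) u = at1 f u * at1 g u :=
  PowerSeries.subst_mul (.of_constantCoeff_zero hu) f g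

lemma constantCoeff_at1 {f : PowerSeries ℂ} (hf : PowerSeries.constantCoeff f = 0) {u : Series}
    (hu : constantCoeff u = 0) : constantCoeff (at1 f u) = 0 :=
  PowerSeries.constantCoeff_subst_eq_zero hu f hf

lemma constantCoeff_at1_exp {u : Series} (hu : constantCoeff u = 0) :
    constantCoeff (at1 (PowerSeries.exp ℂ) u) = 1 := by
  have h1 := constantCoeff_at1 (f := PowerSeries.exp ℂ - 1) (by simp) hu
  rw [at1, PowerSeries.subst_sub (.of_constantCoeff_zero hu), map_sub, sub_eq_zero,
    ← PowerSeries.coe_substAlgHom (.of_constantCoeff_zero hu), map_one, map_one,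
    PowerSeries.coe_substAlgHom (.of_constantCoeff_zero hu)] at h1
  exact h1

lemma at1_exp_pow (k : ℕ) {u : Series} (hu : constantCoeff u = 0) :
    at1 (PowerSeries.exp ℂ) u ^ k = at1 (PowerSeries.exp ℂ) (C (k : ℂ) * u) := by
  have hs : PowerSeries.HasSubst u := .of_constantCoeff_zero hu
  rw [at1, ← PowerSeries.subst_pow hs, PowerSeries.exp_pow_eq_rescale_exp,
    PowerSeries.rescale_eq_subst, PowerSeries.subst_comp_subst_apply
      (PowerSeries.HasSubst.smul_X' _) hs, PowerSeries.subst_smul hs, PowerSeries.subst_X hs, at1,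
    smul_eq_C_mul]

/-- Substitution for `q` in a series composed with a power series in one variable. -/
lemma subst_at1 (f : PowerSeries ℂ) {u v : Series} (hu : constantCoeff u = 0)
    (hv : constantCoeff v = 0) : subst ![z, w, v] (at1 f u) = at1 f (subst ![z, w, v] u) :=
  subst_comp_subst_apply (PowerSeries.HasSubst.of_constantCoeff_zero hu).const
    (hasSubst_vec constantCoeff_z constantCoeff_w hv) f

/-- The power series `T(a * z * w) / z`, written as `a * w * exp(T(a * z * w))`. It is a root of the
kernel if `a` is a `b`-th root of unity. -/
noncomputable def kernelRoot (a : ℂ) : Series :=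
  C a * w * at1 (PowerSeries.exp ℂ) (at1 tree (C a * z * w))

lemma constantCoeff_azw (a : ℂ) : constantCoeff (C a * z * w) = 0 := by
  rw [map_mul, constantCoeff_w, mul_zero]

lemma constantCoeff_kernelRoot (a : ℂ) : constantCoeff (kernelRoot a) = 0 := by
  rw [kernelRoot, map_mul, map_mul, constantCoeff_w, mul_zero, zero_mul]

lemma z_mul_kernelRoot (a : ℂ) : z * kernelRoot a = at1 tree (C a * z * w) := by
  have hs : PowerSeries.HasSubst (C a * z * w) := .of_constantCoeff_zero (constantCoeff_azw a)
  conv_rhs => rw [tree_eq]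
  rw [at1_mul _ _ (constantCoeff_azw a), at1, at1, PowerSeries.subst_X hs,
    PowerSeries.subst_comp_subst_apply hasSubst_tree hs, kernelRoot, at1, at1]
  ring

lemma kernelRoot_pow {b : ℕ} {a : ℂ} (ha : a ^ b = 1) :
    kernelRoot a ^ b = w ^ b * at1 (PowerSeries.exp ℂ) (C (b : ℂ) * z * kernelRoot a) := by
  rw [mul_assoc, z_mul_kernelRoot, ← at1_exp_pow _
    (constantCoeff_at1 constantCoeff_tree (constantCoeff_azw a)), kernelRoot, mul_pow, mul_pow,
    ← map_pow, ha, map_one, one_mul]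

/-- The roots are told apart by their coefficients at `w`. -/
lemma kernelRoot_injective : Function.Injective kernelRoot := by
  have h1 : ∀ a, coeff (Finsupp.single 1 1) (kernelRoot a) = a := by
    intro a
    have h2 : ∀ f : Series, coeff (Finsupp.single 1 1) (w * f) = coeff 0 f := fun f => by
      have := coeff_add_monomial_mul (Finsupp.single (1 : Fin 3) 1) 0 f (1 : ℂ)
      rwa [add_zero, one_mul] at this
    rw [kernelRoot, mul_assoc, coeff_C_mul, h2, coeff_zero_eq_constantCoeff_apply,
      constantCoeff_at1_exp (constantCoeff_at1 constantCoeff_tree (constantCoeff_azw a)), mul_one]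
  intro a a' h
  rw [← h1 a, h, h1]

/-- A polynomial of degree at most `b` with value `1` at `1` is determined by `b` distinct roots. -/
lemma eval_mul_prod_one_sub {R : Type*} [CommRing R] [IsDomain R] {b : ℕ} (P : Polynomial R)
    (hP : P.natDegree ≤ b) (r : ℕ → R) (hr : Set.InjOn r (Finset.range b))
    (hPr : ∀ j ∈ Finset.range b, P.eval (r j) = 0) (hP1 : P.eval 1 = 1) (t : R) :
    P.eval t * ∏ j ∈ Finset.range b, (1 - r j) = ∏ j ∈ Finset.range b, (t - r j) := by
  set D : Polynomial R := ∏ j ∈ Finset.range b, (Polynomial.X - Polynomial.C (r j)) with hD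
  have hDm : D.Monic := Polynomial.monic_prod_of_monic _ _ fun j _ => Polynomial.monic_X_sub_C _
  have hDd : D.natDegree = b := by simp [hD, Polynomial.natDegree_prod_of_monic _ _
    fun j _ => Polynomial.monic_X_sub_C (r j)]
  have hev : ∀ x, D.eval x = ∏ j ∈ Finset.range b, (x - r j) := by
    intro x; simp [hD, Polynomial.eval_prod]
  have hz : P - Polynomial.C (P.coeff b) * D = 0 := by
    refine Polynomial.eq_zero_of_degree_lt_of_eval_index_eq_zero _ hr ?_ fun j hj => ?_
    · rw [Finset.card_range, Polynomial.degree_lt_iff_coeff_zero]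
      intro k hk
      rw [Polynomial.coeff_sub, Polynomial.coeff_C_mul]
      rcases hk.eq_or_lt with rfl | hk
      · have : D.coeff b = 1 := by rw [← hDd]; exact hDm
        rw [this, mul_one, sub_self]
      · rw [Polynomial.coeff_eq_zero_of_natDegree_lt (hP.trans_lt hk),
          Polynomial.coeff_eq_zero_of_natDegree_lt (hDd.le.trans_lt hk), mul_zero, sub_zero]
    · rw [Polynomial.eval_sub, Polynomial.eval_mul, hPr j hj, hev, Finset.prod_eq_zero hj
        (sub_self _), mul_zero, sub_zero]
  have hev' : ∀ x, P.eval x = P.coeff b * ∏ j ∈ Finset.range b, (x - r j) := by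
    intro x
    have := congrArg (Polynomial.eval x) hz
    rwa [Polynomial.eval_sub, Polynomial.eval_mul, Polynomial.eval_C, hev, Polynomial.eval_zero,
      sub_eq_zero] at this
  rw [hev' t, mul_right_comm, ← hev' 1, hP1, one_mul]

/-- The polynomial in `q` on the right-hand side of the kernel equation. -/
noncomputable def kernelPoly (b : ℕ) : Polynomial Series :=
  Polynomial.X ^ b + ∑ s ∈ Finset.range b,
    (Polynomial.X ^ b - Polynomial.X ^ s) * Polynomial.C (w ^ b * allLastBucketGF b s)

lemma eval_kernelPoly (b : ℕ) (t : Series) : (kernelPoly b).eval t =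
    t ^ b + ∑ s ∈ Finset.range b, (t ^ b - t ^ s) * (w ^ b * allLastBucketGF b s) := by
  simp only [kernelPoly, Polynomial.eval_add, Polynomial.eval_finsetSum, Polynomial.eval_mul,
    Polynomial.eval_sub, Polynomial.eval_pow, Polynomial.eval_X, Polynomial.eval_C]

lemma natDegree_kernelPoly_le (b : ℕ) : (kernelPoly b).natDegree ≤ b := by
  refine Polynomial.natDegree_add_le_of_degree_le (Polynomial.natDegree_X_pow_le (R := Series) b) ?_
  refine Polynomial.natDegree_sum_le_of_forall_le _ _ fun s hs => ?_
  refine (Polynomial.natDegree_mul_C_le _ _).trans ?_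
  exact (Polynomial.natDegree_sub_le_of_le (Polynomial.natDegree_X_pow_le (R := Series) b)
    ((Polynomial.natDegree_X_pow_le (R := Series) s).trans (Finset.mem_range.1 hs).le)).trans
      (max_self b).le

/-- The kernel vanishes when a root of it is substituted for `q`, and so does the right-hand side
of the kernel equation. -/
lemma eval_kernelPoly_kernelRoot {b : ℕ} (hb : 1 ≤ b) {a : ℂ} (ha : a ^ b = 1) :
    (kernelPoly b).eval (kernelRoot a) = 0 := by
  have hr := constantCoeff_kernelRoot a
  have hs : HasSubst ![z, w, kernelRoot a] := hasSubst_vec constantCoeff_z constantCoeff_w hr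
  have hzs : subst ![z, w, kernelRoot a] z = z := subst_X hs 0
  have hws : subst ![z, w, kernelRoot a] w = w := subst_X hs 1
  have hqs : subst ![z, w, kernelRoot a] q = kernelRoot a := subst_X hs 2
  have hCs : ∀ x : ℂ, subst ![z, w, kernelRoot a] (C x : Series) = C x := fun x => subst_C x
  have h1 := congrArg (subst ![z, w, kernelRoot a]) (allOverflowGF_mul_kernel hb)
  have hexp : subst ![z, w, kernelRoot a] (at1 (PowerSeries.exp ℂ) (C (b : ℂ) * z * q)) =
      at1 (PowerSeries.exp ℂ) (C (b : ℂ) * z * kernelRoot a) := by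
    rw [subst_at1 _ (by rw [map_mul, map_mul, constantCoeff_z, mul_zero, zero_mul]) hr,
      subst_mul hs, subst_mul hs, hCs, hzs, hqs]
  have hΩ := fun s => (freeOfQ_allLastBucketGF hb s).subst_eq hr
  rw [← coe_substAlgHom hs] at h1 hzs hws hqs hexp hΩ
  simp only [map_mul, map_sub, map_pow, map_add, map_sum, hws, hqs, hexp, hΩ] at h1
  rw [eval_kernelPoly, ← h1, kernelRoot_pow ha, sub_self, mul_zero]

theorem allOverflowGF_mul_kernel_mul_prod {b : ℕ} (hb : 1 ≤ b) :
    allOverflowGF b * (q ^ b - w ^ b * at1 (PowerSeries.exp ℂ) (C (b : ℂ) * z * q)) *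
        ∏ j ∈ Finset.range b, (1 - kernelRoot (omega b ^ j)) =
      ∏ j ∈ Finset.range b, (q - kernelRoot (omega b ^ j)) := by
  have hω := omega_isPrimitiveRoot hb
  have : IsDomain Series := NoZeroDivisors.to_isDomain Series
  rw [allOverflowGF_mul_kernel hb, ← eval_kernelPoly]
  refine eval_mul_prod_one_sub _ (natDegree_kernelPoly_le b) _ ?_ (fun j _ => ?_) ?_ q
  · intro i hi j hj hij
    exact hω.pow_inj (Finset.mem_range.1 hi) (Finset.mem_range.1 hj) (kernelRoot_injective hij)
  · exact eval_kernelPoly_kernelRoot hb (by rw [← pow_mul, mul_comm, pow_mul, hω.pow_eq_one,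
      one_pow])
  · simp [eval_kernelPoly]

lemma toFrac_ne_zero_of_constantCoeff {f : Series} (hf : constantCoeff f = 1) : toFrac f ≠ 0 := by
  rw [Ne, toFrac_eq_zero]
  rintro rfl
  simp at hf

lemma kernel_ne_zero {b : ℕ} (hb : 1 ≤ b) (f : Series) : q ^ b - w ^ b * f ≠ 0 := by
  intro h
  have h1 := congrArg (coeff (Finsupp.single 2 b)) h
  have h2 : coeff (Finsupp.single 2 b) (w ^ b * f) = 0 :=
    X_pow_dvd_iff.1 (dvd_mul_right (X 1 ^ b) f) _ (by
      rw [Finsupp.single_eq_of_ne (by decide)]; omega)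
  classical
  rw [map_sub, h2, q, coeff_X_pow, if_pos rfl] at h1
  simp at h1

lemma toFrac_sub (f g : Series) : toFrac (f - g) = toFrac f - toFrac g := map_sub _ _ _

lemma toFrac_prod {β : Type*} (I : Finset β) (f : β → Series) :
    toFrac (∏ i ∈ I, f i) = ∏ i ∈ I, toFrac (f i) := map_prod _ _ _

theorem CGF_eq {b : ℕ} (hb : 1 ≤ b) (σ : InsertionOrders) :
    toFrac (at3 (CGF b σ) (C (b : ℂ) * z) w q) =
      toFrac (w ^ b * (at1 (PowerSeries.exp ℂ) (C (b : ℂ) * z) -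
          at1 (PowerSeries.exp ℂ) (C (b : ℂ) * z * q))) /
        toFrac ((1 - q) * (q ^ b - w ^ b * at1 (PowerSeries.exp ℂ) (C (b : ℂ) * z * q))) *
      ((∏ j ∈ Finset.range b,
          (toFrac q - toFrac (at1 tree (C (omega b ^ j) * z * w)) / toFrac z)) /
        (∏ j ∈ Finset.range b,
          (1 - toFrac (at1 tree (C (omega b ^ j) * z * w)) / toFrac z))) := by
  have hz : toFrac z ≠ 0 := fun h => by
    have := congrArg (coeff (Finsupp.single 0 1)) (toFrac_eq_zero.1 h)
    rw [z, X, coeff_monomial_same] at this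
    simp at this
  have hroot : ∀ j, toFrac (at1 tree (C (omega b ^ j) * z * w)) / toFrac z =
      toFrac (kernelRoot (omega b ^ j)) := fun j => by
    rw [← z_mul_kernelRoot, toFrac_mul, mul_div_cancel_left₀ _ hz]
  have h1 : (1 : Frac) = toFrac 1 := (map_one _).symm
  simp only [hroot]
  rw [h1]
  simp only [← toFrac_sub, ← toFrac_prod]
  have hne1 : toFrac ((1 - q) *
      (q ^ b - w ^ b * at1 (PowerSeries.exp ℂ) (C (b : ℂ) * z * q))) ≠ 0 := by
    rw [toFrac_mul]
    exact mul_ne_zero (toFrac_ne_zero_of_constantCoeff (by simp [q]))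
      fun h => kernel_ne_zero hb _ (toFrac_eq_zero.1 h)
  have hne2 : toFrac (∏ j ∈ Finset.range b, (1 - kernelRoot (omega b ^ j))) ≠ 0 :=
    toFrac_ne_zero_of_constantCoeff (by simp [constantCoeff_kernelRoot])
  rw [div_mul_div_comm, eq_div_iff (mul_ne_zero hne1 hne2)]
  simp only [← toFrac_mul]
  congr 1
  linear_combination ((q ^ b - w ^ b * at1 (PowerSeries.exp ℂ) (C (b : ℂ) * z * q)) *
    ∏ j ∈ Finset.range b, (1 - kernelRoot (omega b ^ j))) * one_sub_q_mul_CGF hb σ +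
    (w ^ b * (at1 (PowerSeries.exp ℂ) (C (b : ℂ) * z) -
      at1 (PowerSeries.exp ℂ) (C (b : ℂ) * z * q))) * allOverflowGF_mul_kernel_mul_prod hb

end Kernel

end RobinHood

/-- Both identities hold in the field of fractions of `ℂ⟦z, w, q⟧`. In the first one the third
variable, written `s`, is `q ^ (1 / b)`, so that `q = s ^ b`. -/
theorem mainTheorem9 (b : ℕ) (hb : 1 ≤ b) (σ : RobinHood.InsertionOrders) :
    let z : RobinHood.Series := RobinHood.z
    let w : RobinHood.Series := RobinHood.w
    let ω : ℂ := RobinHood.omega b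
    let ι : RobinHood.Series → RobinHood.Frac := RobinHood.toFrac
    let c : ℂ → RobinHood.Series := fun a => MvPowerSeries.C a
    let RH : RobinHood.Series → RobinHood.Series → RobinHood.Series → RobinHood.Series :=
      RobinHood.at3 (RobinHood.RH b σ)
    let C : RobinHood.Series → RobinHood.Series → RobinHood.Series → RobinHood.Series :=
      RobinHood.at3 (RobinHood.CGF b σ)
    let exp : RobinHood.Series → RobinHood.Series := RobinHood.at1 (PowerSeries.exp ℂ)
    let T : RobinHood.Series → RobinHood.Series := RobinHood.at1 RobinHood.tree
    let s : RobinHood.Series := RobinHood.q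
    let q : RobinHood.Series := RobinHood.q
    (ι (RH (c b * z) w (s ^ b)) =
        1 / (b : RobinHood.Frac) *
          ∑ d ∈ Finset.range b, ι (C (c b * z) w (c (ω ^ d) * s)) *
            ∑ p ∈ Finset.range b, (ι (c (ω ^ d) * s)) ^ (-(p : ℤ))) ∧
    (ι (C (c b * z) w q) =
        ι (w ^ b * (exp (c b * z) - exp (c b * z * q))) /
            ι ((1 - q) * (q ^ b - w ^ b * exp (c b * z * q))) *
          ((∏ j ∈ Finset.range b, (ι q - ι (T (c (ω ^ j) * z * w)) / ι z)) /
            (∏ j ∈ Finset.range b, (1 - ι (T (c (ω ^ j) * z * w)) / ι z)))) :=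
  ⟨RobinHood.RH_eq_sum hb σ, RobinHood.CGF_eq hb σ⟩
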